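/- Let $n\ge 0$ be an integer and let $\mathbb{B}^n=\{z\in\mathbb{C}^n:\|z\|<1\}$ be the Euclidean unit ball of $\mathbb{C}^n$. A *normalized Loewner chain* is a family $(f_t)_{t\ge 0}$ of univalent (i.e. holomorphic and injective) maps $f_t:\mathbb{B}^n\to\mathbb{C}^n$ such that $f_s(\mathbb{B}^n)\subseteq f_t(\mathbb{B}^n)$ for $0\le s\le t$, and $f_t(0)=0$, $d(f_t)_0=e^t\,\mathrm{id}$ for all $t\ge 0$. A *Loewner chain of order* $d\in[1,\infty]$ is a family $(f_t)_{t\ge 0}$ of univalent maps $f_t:\mathbb{B}^n\to\mathbb{C}^n$ with $f_s(\mathbb{B}^n)\subseteq f_t(\mathbb{B}^n)$ for $0\le s\le t$, such that for every compact set $K\subset\mathbb{B}^n$ there is a nonnegative function $k_K\in L^d_{\mathrm{loc}}([0,\infty))$ with $$\|f_s(z)-f_t(z)\|\le\int_s^t k_K(\zeta)\,d\zeta\qquad\text{for all } z\in K,\ 0\le s\le t.$$ Put $R(f_t):=\bigcup_{t\ge 0}f_t(\mathbb{B}^n)\subseteq\mathbb{C}^n$. **Proposition.** Let $(f_t)_{t\ge0}$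 be a normalized Loewner chain. Then $(f_t)$ is a Loewner chain of order $\infty$, and $R(f_t)$ is an open subset of $\mathbb{C}^n$ biholomorphic to $\mathbb{C}^n$. Moreover, if the family $(e^{-t}f_t)_{t\ge 0}$ is uniformly bounded on a neighborhood of the origin (that is, there are a neighborhood $U\subseteq\mathbb{B}^n$ of $0$ and a constant $M$ with $\|e^{-t}f_t(z)\|\le M$ for all $z\in U$ and $t\ge 0$), then $R(f_t)=\mathbb{C}^n$. -/

import Mathlib

open scoped ENNReal

/-- `ℂⁿ` with its Euclidean (Hermitian) norm. -/
abbrev CSpace (n : ℕ) : Type := EuclideanSpace ℂ (Fin n)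

/-- The open Euclidean unit ball of `ℂⁿ`. -/
def unitBall (n : ℕ) : Set (CSpace n) := Metric.ball 0 1

/-- A map is univalent on `U` if it is holomorphic and injective on `U`. -/
def IsUnivalentOn {n : ℕ} (f : CSpace n → CSpace n) (U : Set (CSpace n)) : Prop :=
  DifferentiableOn ℂ f U ∧ Set.InjOn f U

/-- An increasing family `(f t)`, `t ≥ 0`, of univalent maps of the ball into `ℂⁿ`.
Values at negative times or outside the ball are irrelevant. -/
structure IsSubordinationChain {n : ℕ} (f : ℝ → CSpace n → CSpace n) : Prop where
  univalent : ∀ t, 0 ≤ t → IsUnivalentOn (f t) (unitBall n)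
  subset : ∀ s t, 0 ≤ s → s ≤ t → f s '' unitBall n ⊆ f t '' unitBall n

/-- A normalized Loewner chain: moreover `f t 0 = 0` and `d(f t)₀ = eᵗ id` for `t ≥ 0`. -/
structure IsNormalizedLoewnerChain {n : ℕ} (f : ℝ → CSpace n → CSpace n) : Prop
    extends IsSubordinationChain f where
  map_zero : ∀ t, 0 ≤ t → f t 0 = 0
  hasFDerivAt_zero : ∀ t, 0 ≤ t →
    HasFDerivAt (f t) ((Real.exp t : ℂ) • ContinuousLinearMap.id ℂ (CSpace n)) 0

/-- `k` restricted to `[0, ∞)` is a nonnegative function in `L^d_loc([0, ∞))`. -/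
def IsNonnegLocLp (k : ℝ → ℝ) (d : ℝ≥0∞) : Prop :=
  (∀ ζ, 0 ≤ ζ → 0 ≤ k ζ) ∧
    ∀ T, 0 ≤ T → MeasureTheory.MemLp k d (MeasureTheory.volume.restrict (Set.Icc 0 T))

/-- A Loewner chain of order `d ∈ [1, ∞]`: for each compact `K` in the ball there is one
nonnegative `k ∈ L^d_loc([0, ∞))` bounding all increments on `K`. -/
structure IsLoewnerChainOfOrder {n : ℕ} (d : ℝ≥0∞) (f : ℝ → CSpace n → CSpace n) : Prop
    extends IsSubordinationChain f where
  one_le : 1 ≤ d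
  bound : ∀ K : Set (CSpace n), IsCompact K → K ⊆ unitBall n →
    ∃ k : ℝ → ℝ, IsNonnegLocLp k d ∧
      ∀ z ∈ K, ∀ s t, 0 ≤ s → s ≤ t → ‖f s z - f t z‖ ≤ ∫ ζ in s..t, k ζ

/-- The union of all the images `f t (𝔹ⁿ)`, `t ≥ 0`. -/
def loewnerRange {n : ℕ} (f : ℝ → CSpace n → CSpace n) : Set (CSpace n) :=
  ⋃ t ∈ Set.Ici (0 : ℝ), f t '' unitBall n

/-- Two open sets of `ℂⁿ` are biholomorphic: there are mutually inverse holomorphic maps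
between them. -/
def AreBiholomorphic {n : ℕ} (U V : Set (CSpace n)) : Prop :=
  IsOpen U ∧ IsOpen V ∧ ∃ F G : CSpace n → CSpace n,
    DifferentiableOn ℂ F U ∧ DifferentiableOn ℂ G V ∧
      Set.MapsTo F U V ∧ Set.MapsTo G V U ∧ Set.InvOn G F U V

/-- The family `(e⁻ᵗ f t)`, `t ≥ 0`, is uniformly bounded on some neighborhood of the origin
contained in the ball. -/
def IsUniformlyBoundedNearZero {n : ℕ} (f : ℝ → CSpace n → CSpace n) : Prop :=
  ∃ U ∈ nhds (0 : CSpace n), U ⊆ unitBall n ∧ ∃ M : ℝ,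
    ∀ t, 0 ≤ t → ∀ z ∈ U, ‖(Real.exp (-t) : ℂ) • f t z‖ ≤ M

/-!
Everything rests on the transition maps `φ_{s,t} = f_t⁻¹ ∘ f_s`, which are self-maps of the ball fixing
the origin, with derivative `e^{s-t} id` there. That they are holomorphic, and that the images of the
`f_t` are open, is Osgood's theorem `fderiv_injective_of_injOn`: an injective holomorphic map between
spaces of the same finite dimension is locally biholomorphic. It is proved by induction on the
dimension. Fixing the components of `f` along the range of its derivative reduces a critical point of
positive rank to a lower dimension, so that the zero set of the Jacobian consists of points of rank
zero; in dimension at least two this set contains a curve, on which `f` would be constant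
(`false_of_fderiv_eq_zero_of_zeros`), and in dimension one Hurwitz' theorem applies
(`deriv_ne_zero_of_injOn`).

*Order `∞`.* For a self-map `φ` of the ball with `φ 0 = 0` and `dφ₀ = c id`, the map `id - φ` is
`O(1 - c)` locally uniformly (`norm_self_sub_le`). Since `f_s - f_t = f_t ∘ φ_{s,t} - f_t` and `f_t` is
Lipschitz on smaller balls, uniformly for `t` bounded, the chain is locally Lipschitz in time.

*The range.* The second order Schwarz lemma for `φ_{s,t} - e^{s-t} id` shows that transition maps
contract the ball to the origin, and that `e^j φ_{t,t+j}` converges uniformly on a fixed ball around the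
origin, with bounds independent of `t`. Hence `Ψ = lim e^k f_k⁻¹` exists and is holomorphic on the
range, and the maps `e^{-m} Ψ ∘ f_m` are normalized and uniformly bounded near the origin
(`IsNormalizedLoewnerChain.loewnerLimit_comp`). They are therefore injective on a ball independent of
`m`, which makes `Ψ` injective, and their images contain a ball independent of `m`
(`ball_subset_image_of_forall_norm_le`), which makes `Ψ` onto `ℂⁿ`. The inverse of `Ψ` is holomorphic
by Osgood's theorem again.

If the maps `e^{-t} f_t` are themselves uniformly bounded near the origin, the same covering theorem
applies to them and shows that the range is everything.
-/

section LoewnerChains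

open Metric Set Filter Topology

/-! ### Holomorphic maps in several variables -/

section SeveralVariables

variable {E F : Type*} [NormedAddCommGroup E] [NormedSpace ℂ E]
  [NormedAddCommGroup F] [NormedSpace ℂ F]

theorem norm_fderiv_le_of_forall_norm_le {f : E → F} {c : E} {r M : ℝ} (hr : 0 < r)
    (hf : DifferentiableOn ℂ f (ball c r)) (hM : ∀ z ∈ ball c r, ‖f z‖ ≤ M) :
    ‖fderiv ℂ f c‖ ≤ 2 * M / r := by
  refine Complex.norm_fderiv_le_div_of_mapsTo_ball hf (fun z hz => ?_) hr
  rw [mem_closedBall, dist_eq_norm]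
  calc ‖f z - f c‖ ≤ ‖f z‖ + ‖f c‖ := norm_sub_le _ _
    _ ≤ 2 * M := by linarith [hM z hz, hM c (mem_ball_self hr)]

/-- Second order Taylor estimate, by the Schwarz lemma of order two. -/
theorem norm_taylor_le {f : E → F} {c : E} {r M : ℝ} (hf : DifferentiableOn ℂ f (ball c r))
    (hM : ∀ z ∈ ball c r, ‖f z‖ ≤ M) {z : E} (hz : z ∈ ball c r) :
    ‖f z - f c - fderiv ℂ f c (z - c)‖ ≤ 4 * M * (‖z - c‖ / r) ^ 2 := by
  have hr : 0 < r := nonempty_ball.1 ⟨z, hz⟩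
  have hA := norm_fderiv_le_of_forall_norm_le hr hf hM
  have hfc : HasFDerivAt f (fderiv ℂ f c) c :=
    (hf.differentiableAt (ball_mem_nhds c hr)).hasFDerivAt
  have key := Complex.dist_le_mul_div_pow_of_mapsTo_ball_of_isLittleO (n := 1)
    (f := fun z => f z - f c - fderiv ℂ f c (z - c)) (c := c) (R₁ := r) (R₂ := 4 * M) (z := z)
    ?_ ?_ ?_ hz
  · simpa [dist_eq_norm] using key
  · exact (hf.sub_const _).sub (by fun_prop)
  · intro y hy
    have hy' : ‖y - c‖ < r := by simpa [dist_eq_norm] using hy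
    simp only [sub_self, map_zero, mem_closedBall, dist_zero_right]
    have h1 : ‖fderiv ℂ f c (y - c)‖ ≤ 2 * M / r * r :=
      ((fderiv ℂ f c).le_opNorm _).trans (by gcongr; exact (norm_nonneg _).trans hA)
    rw [div_mul_cancel₀ _ hr.ne'] at h1
    calc _ ≤ ‖f y‖ + ‖f c‖ + ‖fderiv ℂ f c (y - c)‖ :=
          (norm_sub_le _ _).trans (by gcongr; exact norm_sub_le _ _)
      _ ≤ 4 * M := by linarith [hM y hy, hM c (mem_ball_self hr)]
  · simpa using hfc.isLittleO.norm_right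

/-- **Weierstrass' theorem** in several variables: a uniform limit of holomorphic maps is
holomorphic, and the derivatives converge. -/
theorem hasFDerivAt_of_tendstoUniformlyOn_ball [CompleteSpace F] {ι : Type*} {l : Filter ι}
    [l.NeBot] {f : ι → E → F} {g : E → F} {c : E} {r : ℝ} (hr : 0 < r)
    (hf : ∀ i, DifferentiableOn ℂ (f i) (ball c r))
    (hg : TendstoUniformlyOn f g l (ball c r)) :
    ∃ g' : E →L[ℂ] F, HasFDerivAt g g' c ∧ Tendsto (fun i => fderiv ℂ (f i) c) l (𝓝 g') := by
  have hsub : ∀ x ∈ ball c (r / 2), ball x (r / 2) ⊆ ball c r := fun x hx =>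
    ball_subset_ball' (by rw [mem_ball] at hx; linarith)
  have hCau : UniformCauchySeqOn (fun i => fderiv ℂ (f i)) l (ball c (r / 2)) := by
    intro u hu
    obtain ⟨ε, hε, hεu⟩ := Metric.mem_uniformity_dist.1 hu
    have hδ : 0 < ε * r / 8 := by positivity
    filter_upwards [hg.uniformCauchySeqOn _ (Metric.dist_mem_uniformity hδ)] with m hm x hx
    apply hεu
    have hx' : ∀ i, DifferentiableAt ℂ (f i) x := fun i =>
      (hf i).differentiableAt (isOpen_ball.mem_nhds (ball_subset_ball (by linarith) hx))
    rw [dist_eq_norm, ← fderiv_sub (hx' _) (hx' _)]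
    refine (norm_fderiv_le_of_forall_norm_le (M := ε * r / 8) (half_pos hr)
      (((hf _).sub (hf _)).mono (hsub x hx)) fun z hz => ?_).trans_lt ?_
    · have := hm z (hsub x hx hz)
      rw [dist_eq_norm] at this
      exact this.le
    · field_simp
      linarith
  have hlim : ∀ x ∈ ball c (r / 2), ∃ y, Tendsto (fun i => fderiv ℂ (f i) x) l (𝓝 y) :=
    fun x hx => cauchy_map_iff_exists_tendsto.1 (hCau.cauchy_map hx)
  choose! g' hg' using hlim
  have hg'u := hCau.tendstoUniformlyOn_of_tendsto hg'
  have hc : c ∈ ball c (r / 2) := mem_ball_self (half_pos hr)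
  refine ⟨g' c, hasFDerivAt_of_tendstoUniformlyOn isOpen_ball hg'u (fun i x hx => ?_)
    (fun x hx => hg.tendsto_at (ball_subset_ball (by linarith) hx)) hc, hg' c hc⟩
  exact ((hf i).differentiableAt
    (isOpen_ball.mem_nhds (ball_subset_ball (by linarith) hx))).hasFDerivAt

theorem exists_pos_ball_subset_forall_norm_le {E F : Type*} [SeminormedAddCommGroup E]
    [SeminormedAddCommGroup F] {f : E → F} {U : Set E} (hU : IsOpen U)
    (hf : ContinuousOn f U) {c : E} (hc : c ∈ U) :
    ∃ r > 0, ball c r ⊆ U ∧ ∀ z ∈ ball c r, ‖f z‖ ≤ ‖f c‖ + 1 := by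
  have h1 : ∀ᶠ z in 𝓝 c, z ∈ U ∧ ‖f z‖ < ‖f c‖ + 1 :=
    (hU.eventually_mem hc).and
      ((hf.continuousAt (hU.mem_nhds hc)).norm.eventually_lt continuousAt_const (by simp))
  obtain ⟨r, hr, h⟩ := Metric.eventually_nhds_iff_ball.1 h1
  exact ⟨r, hr, fun z hz => (h z hz).1, fun z hz => (h z hz).2.le⟩

/-- Directional derivatives of holomorphic maps are holomorphic: they are locally uniform limits
of difference quotients. -/
theorem differentiableOn_fderiv_apply [CompleteSpace F] {f : E → F} {U : Set E} (hU : IsOpen U)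
    (hf : DifferentiableOn ℂ f U) (v : E) : DifferentiableOn ℂ (fun z => fderiv ℂ f z v) U := by
  intro c hc
  obtain ⟨r, hr, hrU, hM⟩ := exists_pos_ball_subset_forall_norm_le hU hf.continuousOn hc
  set M := ‖f c‖ + 1
  have hM0 : 0 < M := by positivity
  set η : ℝ := r / (2 * (‖v‖ + 1)) with hη
  have hη0 : 0 < η := by positivity
  have hηv : η * ‖v‖ < r / 2 := by
    rw [hη, div_mul_eq_mul_div, div_lt_div_iff₀ (by positivity) (by positivity)]
    nlinarith [norm_nonneg v]
  let h : ℕ → ℂ := fun k => ((η / (k + 1) : ℝ) : ℂ)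
  have hh : ∀ k, ‖h k‖ = η / (k + 1) := fun k => by
    simp only [h, Complex.norm_real, Real.norm_eq_abs]
    exact abs_of_pos (by positivity)
  have hh0 : ∀ k, h k ≠ 0 := fun k => norm_pos_iff.1 (by rw [hh]; positivity)
  have hhv : ∀ k, ‖h k • v‖ < r / 2 := fun k => by
    rw [norm_smul, hh]
    refine lt_of_le_of_lt ?_ hηv
    gcongr
    exact div_le_self hη0.le (by linarith [(Nat.cast_nonneg k : (0 : ℝ) ≤ k)])
  have hsub : ∀ x ∈ ball c (r / 2), ball x (r / 2) ⊆ ball c r := fun x hx =>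
    ball_subset_ball' (by rw [mem_ball] at hx; linarith)
  have hadd : ∀ x ∈ ball c (r / 2), ∀ k, x + h k • v ∈ ball x (r / 2) := fun x hx k => by
    simpa using hhv k
  have hdiff : ∀ k, DifferentiableOn ℂ (fun z => (h k)⁻¹ • (f (z + h k • v) - f z))
      (ball c (r / 2)) := by
    intro k
    refine DifferentiableOn.const_smul (DifferentiableOn.sub ?_
      (hf.mono ((ball_subset_ball (by linarith)).trans hrU))) _
    exact hf.comp (by fun_prop) fun z hz => hrU (hsub z hz (hadd z hz k))
  have hunif : TendstoUniformlyOn (fun (k : ℕ) z => (h k)⁻¹ • (f (z + h k • v) - f z))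
      (fun z => fderiv ℂ f z v) atTop (ball c (r / 2)) := by
    rw [Metric.tendstoUniformlyOn_iff]
    intro ε hε
    have hlim : Tendsto (fun k : ℕ => η / ((k : ℝ) + 1) * (4 * M * (‖v‖ / (r / 2)) ^ 2)) atTop
        (𝓝 (0 * (4 * M * (‖v‖ / (r / 2)) ^ 2))) :=
      (tendsto_const_div_atTop_nhds_zero_nat η |>.comp (tendsto_add_atTop_nat 1) |>.congr
        (by simp)).mul_const _
    rw [zero_mul] at hlim
    filter_upwards [hlim.eventually_lt_const hε] with k hk z hz
    refine lt_of_le_of_lt ?_ hk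
    have hT := norm_taylor_le (hf.mono ((hsub z hz).trans hrU))
      (fun y hy => hM y (hsub z hz hy)) (hadd z hz k)
    rw [dist_eq_norm, norm_sub_rev]
    have : (h k)⁻¹ • (f (z + h k • v) - f z) - fderiv ℂ f z v
        = (h k)⁻¹ • (f (z + h k • v) - f z - fderiv ℂ f z (z + h k • v - z)) := by
      rw [add_sub_cancel_left, map_smul, smul_sub, smul_sub, smul_sub, inv_smul_smul₀ (hh0 k)]
    rw [this, norm_smul, norm_inv]
    refine (mul_le_mul_of_nonneg_left hT (by positivity)).trans_eq ?_
    rw [add_sub_cancel_left, norm_smul, hh]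
    field_simp
  obtain ⟨g', hg', -⟩ := hasFDerivAt_of_tendstoUniformlyOn_ball (half_pos hr) hdiff hunif
  exact hg'.differentiableAt.differentiableWithinAt

/-- Holomorphic maps of several variables are smooth. -/
theorem contDiffOn_natCast_of_differentiableOn [FiniteDimensional ℂ E] [CompleteSpace F]
    {f : E → F} {U : Set E} (hU : IsOpen U) (hf : DifferentiableOn ℂ f U) (n : ℕ) :
    ContDiffOn ℂ n f U := by
  induction n generalizing f with
  | zero => exact contDiffOn_zero.2 hf.continuousOn
  | succ n ih =>
    push_cast
    rw [contDiffOn_succ_iff_fderiv_of_isOpen hU]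
    exact ⟨hf, by simp, contDiffOn_clm_apply.2 fun v => ih (differentiableOn_fderiv_apply hU hf v)⟩

theorem contDiffAt_one_of_differentiableOn [FiniteDimensional ℂ E] [CompleteSpace F]
    {f : E → F} {U : Set E} (hU : IsOpen U) (hf : DifferentiableOn ℂ f U) {c : E} (hc : c ∈ U) :
    ContDiffAt ℂ 1 f c :=
  mod_cast (contDiffOn_natCast_of_differentiableOn hU hf 1).contDiffAt (hU.mem_nhds hc)

theorem differentiableOn_fderiv [FiniteDimensional ℂ E] [CompleteSpace F] {f : E → F} {U : Set E}
    (hU : IsOpen U) (hf : DifferentiableOn ℂ f U) : DifferentiableOn ℂ (fderiv ℂ f) U :=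
  ((contDiffOn_succ_iff_fderiv_of_isOpen (n := 1) hU).1
    (mod_cast contDiffOn_natCast_of_differentiableOn hU hf 2)).2.2.differentiableOn (by simp)

end SeveralVariables

/-! ### Hurwitz' theorem and injective holomorphic functions of one variable -/

section Hurwitz

/-- **Hurwitz' theorem** with a parameter: if `h x₀` vanishes at `p` but nowhere on a circle around
`p`, then so does every `h x` with `x` near `x₀` somewhere inside that circle. -/
theorem eventually_exists_zero_mem_ball {X : Type*} [TopologicalSpace X] {h : X → ℂ → ℂ} {x₀ : X}
    {p : ℂ} {r : ℝ} (hr : 0 < r) (hd : ∀ᶠ x in 𝓝 x₀, DiffContOnCl ℂ (h x) (ball p r))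
    (hp : Tendsto (fun x => h x p) (𝓝 x₀) (𝓝 0))
    (hs : ∀ z ∈ sphere p r, ContinuousAt (fun q : X × ℂ => h q.1 q.2) (x₀, z))
    (hne : ∀ z ∈ sphere p r, h x₀ z ≠ 0) :
    ∀ᶠ x in 𝓝 x₀, ∃ z ∈ ball p r, h x z = 0 := by
  have hcont : ContinuousOn (fun z => ‖h x₀ z‖) (sphere p r) := fun z hz =>
    ((hs z hz).comp (f := fun z : ℂ => (x₀, z)) (by fun_prop)).norm.continuousWithinAt
  obtain ⟨z₁, hz₁, hmin⟩ := (isCompact_sphere p r).exists_isMinOn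
    (NormedSpace.sphere_nonempty.2 hr.le) hcont
  set ε := ‖h x₀ z₁‖
  have hε : 0 < ε := norm_pos_iff.2 (hne z₁ hz₁)
  have h1 : ∀ᶠ x in 𝓝 x₀, ∀ z ∈ sphere p r, ε / 2 < ‖h x z‖ :=
    (isCompact_sphere p r).eventually_forall_of_forall_eventually fun z hz =>
      (hs z hz).norm.eventually_const_lt ((half_lt_self hε).trans_le (hmin hz))
  have h2 : ∀ᶠ x in 𝓝 x₀, ‖h x p‖ < ε / 2 :=
    hp.norm.eventually_lt_const (by simpa using hε)
  filter_upwards [hd, h1, h2] with x hdx h1x h2x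
  by_contra! hzero
  have hcl : ∀ z ∈ closure (ball p r), h x z ≠ 0 := by
    intro z hz
    rw [closure_ball p hr.ne', ← ball_union_sphere] at hz
    rcases hz with hz | hz
    · exact hzero z hz
    · exact norm_pos_iff.1 ((half_pos hε).trans (h1x z hz))
  have := Complex.norm_le_of_forall_mem_frontier_norm_le isBounded_ball (hdx.inv hcl)
    (C := (ε / 2)⁻¹) (fun z hz => ?_) (subset_closure (mem_ball_self hr))
  · rw [Pi.inv_apply, norm_inv,
      inv_le_inv₀ (norm_pos_iff.2 (hzero p (mem_ball_self hr))) (half_pos hε)] at this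
    exact absurd this (not_le.2 h2x)
  · rw [frontier_ball p hr.ne'] at hz
    rw [Pi.inv_apply, norm_inv]
    gcongr
    exact (h1x z hz).le

theorem exists_sphere_forall_ne_zero {g : ℂ → ℂ} {p : ℂ} (hg : AnalyticAt ℂ g p)
    (hne : ¬ ∀ᶠ z in 𝓝 p, g z = 0) {ε : ℝ} (hε : 0 < ε) :
    ∃ r, 0 < r ∧ r < ε ∧ ∀ z ∈ sphere p r, g z ≠ 0 := by
  have h := hg.eventually_eq_zero_or_eventually_ne_zero.resolve_left hne
  rw [eventually_nhdsWithin_iff] at h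
  obtain ⟨δ, hδ, h⟩ := Metric.eventually_nhds_iff_ball.1 h
  have hm : 0 < min δ ε := lt_min hδ hε
  refine ⟨min δ ε / 2, half_pos hm, (half_lt_self hm).trans_le (min_le_right _ _), fun z hz => ?_⟩
  rw [mem_sphere] at hz
  refine h z ?_ ?_
  · rw [mem_ball, hz]
    exact (half_lt_self hm).trans_le (min_le_left _ _)
  · rintro rfl
    rw [dist_self] at hz
    linarith

theorem eventually_eq_of_eventually_hasDerivAt_zero {F : Type*} [NormedAddCommGroup F]
    [NormedSpace ℂ F] {g : ℂ → F} {p : ℂ} (hg : ∀ᶠ b in 𝓝 p, HasDerivAt g 0 b) :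
    ∀ᶠ b in 𝓝 p, g b = g p := by
  obtain ⟨r, hr, h⟩ := Metric.eventually_nhds_iff_ball.1 hg
  filter_upwards [ball_mem_nhds p hr] with b hb
  exact isOpen_ball.is_const_of_deriv_eq_zero (convex_ball p r).isPreconnected
    (fun x hx => (h x hx).differentiableAt.differentiableWithinAt)
    (fun x hx => (h x hx).deriv) hb (mem_ball_self hr)

variable {E F : Type*} [NormedAddCommGroup E] [NormedSpace ℂ E]
  [NormedAddCommGroup F] [NormedSpace ℂ F]

/-- A curve of critical points of an injective map is constant. -/
theorem eventually_eq_of_fderiv_comp_eq_zero {f : E → F} {U : Set E} (hU : IsOpen U)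
    (hf : DifferentiableOn ℂ f U) (hinj : InjOn f U) {γ : ℂ → E} {p : ℂ}
    (hγ : ∀ᶠ b in 𝓝 p, DifferentiableAt ℂ γ b ∧ γ b ∈ U ∧ fderiv ℂ f (γ b) = 0) :
    ∀ᶠ b in 𝓝 p, γ b = γ p := by
  have h1 : ∀ᶠ b in 𝓝 p, HasDerivAt (f ∘ γ) 0 b := by
    filter_upwards [hγ] with b ⟨hd, hbU, h0⟩
    have := (hf.differentiableAt (hU.mem_nhds hbU)).hasFDerivAt.comp_hasDerivAt b hd.hasDerivAt
    simpa [h0] using this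
  filter_upwards [eventually_eq_of_eventually_hasDerivAt_zero h1, hγ] with b hb hγb
  exact hinj hγb.2.1 hγ.self_of_nhds.2.1 hb

theorem dslope_swap {f : ℂ → ℂ} (a b : ℂ) : dslope f a b = dslope f b a := by
  rcases eq_or_ne a b with rfl | h
  · rfl
  · rw [dslope_of_ne _ h.symm, dslope_of_ne _ h, slope_comm]

/-- The one-variable case: if `f' p = 0`, then Hurwitz' theorem for the difference quotients
`z ↦ (f z - f w) / (z - w)`, which have no zero off the diagonal, shows that `f'` vanishes near
`p`. -/
theorem deriv_ne_zero_of_injOn {f : ℂ → ℂ} {U : Set ℂ} (hU : IsOpen U)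
    (hf : DifferentiableOn ℂ f U) (hinj : InjOn f U) {p : ℂ} (hp : p ∈ U) : deriv f p ≠ 0 := by
  intro h0
  obtain ⟨r, hr, hrU⟩ := nhds_basis_closedBall.mem_iff.1 (hU.mem_nhds hp)
  have hslope : ∀ w ∈ U, ∀ z ∈ U, z ≠ w → dslope f w z ≠ 0 := by
    intro w hw z hz hne
    rw [dslope_of_ne _ hne, slope_def_field]
    exact div_ne_zero (sub_ne_zero.2 fun h => hne (hinj hz hw h)) (sub_ne_zero.2 hne)
  have key := eventually_exists_zero_mem_ball (h := fun w z => dslope f w z) (x₀ := p) (p := p) hr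
    ?_ ?_ ?_ ?_
  · have hd : ∀ᶠ w in 𝓝 p, HasDerivAt f 0 w := by
      filter_upwards [key, hU.mem_nhds hp] with w ⟨z, hz, hzw⟩ hw
      have : z = w := by
        by_contra hne
        exact hslope w hw z (hrU (ball_subset_closedBall hz)) hne hzw
      rw [this, dslope_same] at hzw
      rw [← hzw]
      exact (hf.differentiableAt (hU.mem_nhds hw)).hasDerivAt
    have hc := eventually_eq_of_eventually_hasDerivAt_zero hd
    have hc' : ∀ᶠ w in 𝓝[≠] p, False := by
      filter_upwards [hc.filter_mono nhdsWithin_le_nhds, self_mem_nhdsWithin,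
        mem_nhdsWithin_of_mem_nhds (hU.mem_nhds hp)] with w hw hne hwU
      exact hne (hinj hwU hp hw)
    exact hc'.exists.choose_spec
  · filter_upwards [hU.mem_nhds hp] with w hw
    refine DifferentiableOn.diffContOnCl ?_
    rw [closure_ball p hr.ne']
    exact ((Complex.differentiableOn_dslope (hU.mem_nhds hw)).2 hf).mono hrU
  · have := continuousAt_dslope_same.2 (hf.differentiableAt (hU.mem_nhds hp))
    simp_rw [dslope_swap _ p]
    simpa [ContinuousAt, h0] using this
  · intro z hz
    have hne : z ≠ p := ne_of_mem_sphere hz hr.ne'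
    have hzU : z ∈ U := hrU (sphere_subset_closedBall hz)
    have h1 : ∀ᶠ q : ℂ × ℂ in 𝓝 (p, z), q.2 ≠ q.1 :=
      (isOpen_ne_fun continuous_snd continuous_fst).mem_nhds hne
    have h2 : (fun q : ℂ × ℂ => dslope f q.1 q.2) =ᶠ[𝓝 (p, z)]
        fun q => (f q.2 - f q.1) / (q.2 - q.1) := by
      filter_upwards [h1] with q hq
      rw [dslope_of_ne _ hq, slope_def_field]
    refine ContinuousAt.congr ?_ h2.symm
    have hfz := (hf.differentiableAt (hU.mem_nhds hzU)).continuousAt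
    have hfp := (hf.differentiableAt (hU.mem_nhds hp)).continuousAt
    exact ((hfz.comp (f := Prod.snd) (x := (p, z)) continuousAt_snd).sub
      (hfp.comp (f := Prod.fst) (x := (p, z)) continuousAt_fst)).div
      (by fun_prop) (sub_ne_zero.2 hne)
  · exact fun z hz => hslope p hp z (hrU (sphere_subset_closedBall hz)) (ne_of_mem_sphere hz hr.ne')

end Hurwitz

/-! ### Osgood's theorem -/

section Osgood

variable {E F : Type*} [NormedAddCommGroup E] [NormedSpace ℂ E]
  [NormedAddCommGroup F] [NormedSpace ℂ F]

theorem iteratedDeriv_comp_line {g : E → ℂ} {U : Set E} (hU : IsOpen U) (v : E)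
    (hg : ∀ k, DifferentiableOn ℂ ((fun (u : E → ℂ) z => fderiv ℂ u z v)^[k] g) U) (q : E) (k : ℕ)
    {a : ℂ} (ha : q + a • v ∈ U) :
    iteratedDeriv k (fun a : ℂ => g (q + a • v)) a
      = ((fun (u : E → ℂ) z => fderiv ℂ u z v)^[k] g) (q + a • v) := by
  induction k generalizing a with
  | zero => simp
  | succ k ih =>
    have hev : ∀ᶠ b in 𝓝 a, q + b • v ∈ U :=
      (by fun_prop : Continuous fun b : ℂ => q + b • v).continuousAt.eventually (hU.mem_nhds ha)
    have hline : HasDerivAt (fun b : ℂ => q + b • v) v a := by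
      simpa using ((hasDerivAt_id a).smul_const v).const_add q
    rw [iteratedDeriv_succ, EventuallyEq.deriv_eq (hev.mono fun b hb => ih hb),
      Function.iterate_succ_apply']
    exact (((hg k).differentiableAt (hU.mem_nhds ha)).hasFDerivAt.comp_hasDerivAt a hline).deriv

/-- In dimension at least two, an injective map cannot be critical along a nonempty hypersurface:
at a suitable point of the zero set, some iterated directional derivative of the defining function
is a submersion vanishing on the zero set, which therefore contains a curve. -/
theorem false_of_fderiv_eq_zero_of_zeros [FiniteDimensional ℂ E] (hE : 1 < Module.finrank ℂ E)
    {f : E → F} {U : Set E} (hU : IsOpen U) (hf : DifferentiableOn ℂ f U) (hinj : InjOn f U)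
    {h : E → ℂ} (hh : DifferentiableOn ℂ h U) (hcrit : ∀ z ∈ U, h z = 0 → fderiv ℂ f z = 0)
    {p : E} (hpU : p ∈ U) (hp : h p = 0) : False := by
  have : Nontrivial E := Module.nontrivial_of_finrank_pos (R := ℂ) (by omega)
  obtain ⟨v, hv⟩ := exists_ne (0 : E)
  obtain ⟨w, hvw⟩ := exists_linearIndependent_pair_of_one_lt_finrank hE hv
  set D : ℕ → E → ℂ := fun k => (fun (u : E → ℂ) z => fderiv ℂ u z v)^[k] h with hD
  have hDd : ∀ k, DifferentiableOn ℂ (D k) U := by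
    intro k
    induction k with
    | zero => exact hh
    | succ k ih =>
      simp only [hD, Function.iterate_succ_apply']
      exact differentiableOn_fderiv_apply hU ih v
  have hDs : ∀ k z, D (k + 1) z = fderiv ℂ (D k) z v := fun k z => by
    simp only [hD, Function.iterate_succ_apply']
  have hmem : ∀ q ∈ U, ∀ᶠ a in 𝓝 (0 : ℂ), q + a • v ∈ U := fun q hq =>
    (by fun_prop : Continuous fun b : ℂ => q + b • v).continuousAt.eventually
      (hU.mem_nhds (by simpa using hq))
  have han : ∀ q ∈ U, AnalyticAt ℂ (fun a : ℂ => h (q + a • v)) 0 := by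
    intro q hq
    rw [Complex.analyticAt_iff_eventually_differentiableAt]
    filter_upwards [hmem q hq] with a ha
    exact (hh.differentiableAt (hU.mem_nhds ha)).comp a (f := fun a : ℂ => q + a • v) (by fun_prop)
  -- `h` does not vanish on lines in direction `v`, since `f` would be constant on them.
  have hnz : ∀ q ∈ U, ¬ ∀ᶠ a in 𝓝 (0 : ℂ), h (q + a • v) = 0 := by
    intro q hq hev
    have := eventually_eq_of_fderiv_comp_eq_zero hU hf hinj (γ := fun a : ℂ => q + a • v) (p := 0)
      (by filter_upwards [hev, hmem q hq] with a ha haU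
          exact ⟨by fun_prop, haU, hcrit _ haU ha⟩)
    have h' : ∀ᶠ a in 𝓝[≠] (0 : ℂ), False := by
      filter_upwards [this.filter_mono nhdsWithin_le_nhds, self_mem_nhdsWithin] with a ha hne
      simp [hv] at ha
      exact hne ha
    exact h'.exists.choose_spec
  have hex : ∃ k, ∃ q ∈ U, h q = 0 ∧ D k q ≠ 0 := by
    by_contra! hall
    refine hnz p hpU (analyticOrderAt_eq_top.1 ?_)
    refine ENat.eq_top_iff_forall_ge.2 fun k => ?_
    rw [natCast_le_analyticOrderAt_iff_iteratedDeriv_eq_zero (han p hpU)]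
    intro i _
    rw [iteratedDeriv_comp_line hU v hDd p i (by simpa using hpU)]
    simpa using hall i p hpU hp
  classical
  obtain ⟨q, hqU, hq0, hqm⟩ := Nat.find_spec hex
  have hmin := fun k => Nat.find_min hex (m := k)
  obtain ⟨m, hm⟩ : ∃ m, Nat.find hex = m + 1 := by
    refine Nat.exists_eq_succ_of_ne_zero fun h0 => hqm ?_
    rw [h0]
    exact hq0
  rw [hm, hDs] at hqm
  -- `D m` vanishes on the zero set of `h` but has a nonzero derivative at `q`.
  have hg0 : ∀ z ∈ U, h z = 0 → D m z = 0 := by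
    intro z hz hz0
    by_contra hne
    exact hmin m (by omega) ⟨z, hz, hz0, hne⟩
  let ι : ℂ × ℂ → E := fun x => q + x.2 • v + x.1 • w
  have hι0 : ι (0, 0) = q := by simp [ι]
  have hιd : HasFDerivAt ι ((ContinuousLinearMap.snd ℂ ℂ ℂ).smulRight v
      + (ContinuousLinearMap.fst ℂ ℂ ℂ).smulRight w) (0, 0) :=
    (((ContinuousLinearMap.snd ℂ ℂ ℂ).smulRight v).hasFDerivAt.const_add q).add
      ((ContinuousLinearMap.fst ℂ ℂ ℂ).smulRight w).hasFDerivAt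
  have hιc : ContDiff ℂ 1 ι := by fun_prop
  have hιU : ∀ᶠ x in 𝓝 ((0, 0) : ℂ × ℂ), ι x ∈ U :=
    hιc.continuous.continuousAt.eventually (hU.mem_nhds (by rwa [hι0]))
  have hGc : ContDiffAt ℂ 1 (D m ∘ ι) (0, 0) := by
    refine ContDiffAt.comp _ ?_ hιc.contDiffAt
    rw [hι0]
    exact contDiffAt_one_of_differentiableOn hU (hDd m) hqU
  have hGd : fderiv ℂ (D m ∘ ι) (0, 0) ∘L .inr ℂ ℂ ℂ
      = ContinuousLinearMap.toSpanSingleton ℂ (fderiv ℂ (D m) q v) := by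
    have hDq : HasFDerivAt (D m) (fderiv ℂ (D m) q) (ι (0, 0)) := by
      rw [hι0]
      exact ((hDd m).differentiableAt (hU.mem_nhds hqU)).hasFDerivAt
    rw [(hDq.comp _ hιd).fderiv]
    ext
    simp
  have hinv : (fderiv ℂ (D m ∘ ι) (0, 0) ∘L .inr ℂ ℂ ℂ).IsInvertible := by
    rw [hGd]
    refine ContinuousLinearMap.IsInvertible.of_inverse
      (g := ContinuousLinearMap.toSpanSingleton ℂ (fderiv ℂ (D m) q v)⁻¹) ?_ ?_ <;>
    · ext
      simp [hqm]
  set ψ := hGc.implicitFunction one_ne_zero hinv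
  have hψd : ∀ᶠ b in 𝓝 (0 : ℂ), DifferentiableAt ℂ ψ b :=
    ((hGc.contDiffAt_implicitFunction one_ne_zero hinv).eventually (by simp)).mono
      fun b hb => hb.differentiableAt one_ne_zero
  have hψ0 : ψ 0 = 0 := hGc.implicitFunction_apply_self one_ne_zero hinv
  have hψ := hGc.eventually_apply_eq_iff_implicitFunction one_ne_zero hinv
  obtain ⟨ε, hε, hball⟩ := Metric.eventually_nhds_iff_ball.1 (hψ.and hιU)
  obtain ⟨r, hr, hrε, hsph⟩ := exists_sphere_forall_ne_zero (han q hqU) (hnz q hqU) hε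
  have hbox : ∀ᶠ b in 𝓝 (0 : ℂ), ∀ a ∈ closedBall (0 : ℂ) r, (b, a) ∈ ball ((0, 0) : ℂ × ℂ) ε := by
    filter_upwards [ball_mem_nhds (0 : ℂ) hε] with b hb a ha
    rw [mem_ball, Prod.dist_eq]
    exact max_lt hb ((mem_closedBall.1 ha).trans_lt hrε)
  have hhι : ∀ x ∈ ball ((0, 0) : ℂ × ℂ) ε, ContinuousAt (fun y : ℂ × ℂ => h (ι y)) x :=
    fun x hx => (hh.differentiableAt (hU.mem_nhds (hball x hx).2)).continuousAt.comp
      hιc.continuous.continuousAt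
  have hzero := eventually_exists_zero_mem_ball (h := fun b a => h (ι (b, a))) (x₀ := 0) (p := 0)
    hr ?_ ?_ ?_ ?_
  · have hcurve : ∀ᶠ b in 𝓝 (0 : ℂ), ι (b, ψ b) = ι (0, ψ 0) := by
      refine eventually_eq_of_fderiv_comp_eq_zero hU hf hinj (γ := fun b => ι (b, ψ b)) ?_
      filter_upwards [hzero, hbox, hψd] with b ⟨a, ha, hba⟩ hb hd
      have hbU := hball _ (hb a (ball_subset_closedBall ha))
      have hψa : ψ b = a := hbU.1.1 (by
        simp only [Function.comp_apply, hι0, hg0 q hqU hq0]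
        exact hg0 _ hbU.2 hba)
      rw [hψa]
      exact ⟨(hιc.differentiable one_ne_zero).differentiableAt.comp b
        (differentiableAt_id.prodMk hd), hbU.2, hcrit _ hbU.2 hba⟩
    have h' : ∀ᶠ b in 𝓝[≠] (0 : ℂ), False := by
      filter_upwards [hcurve.filter_mono nhdsWithin_le_nhds, self_mem_nhdsWithin] with b hb hne
      rw [hψ0, hι0] at hb
      have hb' : ψ b • v + b • w = 0 := by simpa [ι, add_assoc] using hb
      exact hne (LinearIndependent.pair_iff.1 hvw _ _ hb').2
    exact h'.exists.choose_spec
  · filter_upwards [hbox] with b hb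
    refine DifferentiableOn.diffContOnCl ?_
    rw [closure_ball _ hr.ne']
    intro a ha
    exact ((hh.differentiableAt (hU.mem_nhds (hball _ (hb a ha)).2)).comp a
      (f := fun a => ι (b, a)) (by fun_prop)).differentiableWithinAt
  · have := (hhι (0, 0) (mem_ball_self hε)).comp (f := fun b : ℂ => (b, (0 : ℂ))) (x := 0)
      (by fun_prop)
    simpa [ContinuousAt, Function.comp_def, hι0, hq0] using this
  · intro a ha
    exact hhι (0, a) (hbox.self_of_nhds a (sphere_subset_closedBall ha))
  · intro a ha
    simpa [ι] using hsph a ha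

/-- The case of a critical point of rank zero. -/
theorem fderiv_ne_zero_of_injOn [FiniteDimensional ℂ E] [FiniteDimensional ℂ F] [Nontrivial E]
    (hEF : Module.finrank ℂ E = Module.finrank ℂ F) {f : E → F} {U : Set E} (hU : IsOpen U)
    (hf : DifferentiableOn ℂ f U) (hinj : InjOn f U)
    (hrank : ∀ z ∈ U, fderiv ℂ f z ≠ 0 → Function.Injective (fderiv ℂ f z)) {p : E} (hp : p ∈ U) :
    fderiv ℂ f p ≠ 0 := by
  intro h0
  have hpos : 0 < Module.finrank ℂ E := Module.finrank_pos
  rcases (Nat.succ_le_of_lt hpos).lt_or_eq with h1 | h1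
  · let e : F ≃L[ℂ] E := ContinuousLinearEquiv.ofFinrankEq hEF.symm
    let b := Module.finBasis ℂ E
    set h : E → ℂ := fun z =>
      (LinearMap.toMatrix b b (e.toLinearEquiv.toLinearMap ∘ₗ (fderiv ℂ f z).toLinearMap)).det
      with hh
    have hdet : ∀ z, h z = 0 ↔ ¬ Function.Injective (fderiv ℂ f z) := by
      intro z
      simp only [hh]
      rw [LinearMap.det_toMatrix, LinearMap.det_eq_zero_iff_ker_ne_bot,
        LinearEquiv.ker_comp, ne_eq, LinearMap.ker_eq_bot]
      rfl
    refine false_of_fderiv_eq_zero_of_zeros h1 hU hf hinj (h := h) ?_ ?_ hp ?_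
    · simp only [hh, Matrix.det_apply]
      refine DifferentiableOn.fun_sum fun σ _ => DifferentiableOn.fun_const_smul ?_ _
      intro z hz
      refine (HasFDerivWithinAt.finsetProd fun i _ => DifferentiableWithinAt.hasFDerivWithinAt
        ?_).differentiableWithinAt
      simp only [LinearMap.toMatrix_apply]
      exact (LinearMap.toContinuousLinearMap (b.coord (σ i) ∘ₗ
        e.toLinearEquiv.toLinearMap)).differentiable.comp_differentiableOn
          (differentiableOn_fderiv_apply hU hf (b i)) z hz
    · intro z hz hz0
      by_contra hne
      exact (hdet z).1 hz0 (hrank z hz hne)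
    · rw [hdet, h0]
      intro hi
      obtain ⟨v, hv⟩ := exists_ne (0 : E)
      exact hv (hi (by simp))
  · have h1E : Module.finrank ℂ ℂ = Module.finrank ℂ E := by simpa using h1
    let e : ℂ ≃L[ℂ] E := ContinuousLinearEquiv.ofFinrankEq h1E
    let e' : F ≃L[ℂ] ℂ := ContinuousLinearEquiv.ofFinrankEq (h1E.trans hEF).symm
    have hV : IsOpen (e ⁻¹' U) := hU.preimage e.continuous
    have hp' : e.symm p ∈ e ⁻¹' U := by simpa using hp
    refine deriv_ne_zero_of_injOn (f := e' ∘ f ∘ e) hV ?_ ?_ hp' ?_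
    · exact e'.differentiable.comp_differentiableOn
        (hf.comp e.differentiable.differentiableOn fun x hx => hx)
    · exact e'.injective.comp_injOn
        (hinj.comp e.injective.injOn fun x hx => hx)
    · have hfp : HasFDerivAt f (0 : E →L[ℂ] F) (e (e.symm p)) := by
        rw [e.apply_symm_apply, ← h0]
        exact (hf.differentiableAt (hU.mem_nhds hp)).hasFDerivAt
      have := (e'.hasFDerivAt.comp _ (hfp.comp _ e.hasFDerivAt)).hasDerivAt.deriv
      simpa using this

/-- **Osgood's theorem**: an injective holomorphic map between spaces of equal finite dimension has
invertible derivative everywhere. -/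
theorem fderiv_injective_of_injOn {E : Type*} {F : Type*} [NormedAddCommGroup E] [NormedSpace ℂ E]
    [NormedAddCommGroup F] [NormedSpace ℂ F] [FiniteDimensional ℂ E] [FiniteDimensional ℂ F]
    (hEF : Module.finrank ℂ E = Module.finrank ℂ F) {f : E → F} {U : Set E} (hU : IsOpen U)
    (hf : DifferentiableOn ℂ f U) (hinj : InjOn f U) {p : E} (hp : p ∈ U) :
    Function.Injective (fderiv ℂ f p) := by
  obtain ⟨n, hn⟩ : ∃ n, Module.finrank ℂ E = n := ⟨_, rfl⟩
  induction n using Nat.strong_induction_on generalizing E F with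
  | _ n ih =>
  rcases subsingleton_or_nontrivial E with hE | hE
  · exact Function.injective_of_subsingleton _
  have hrank : ∀ z ∈ U, fderiv ℂ f z ≠ 0 → Function.Injective (fderiv ℂ f z) := by
    intro z hz hne
    set A := fderiv ℂ f z with hA
    obtain ⟨K, hK⟩ := Submodule.exists_isCompl A.range
    let π : F →L[ℂ] A.range := (A.range.projectionOnto K hK).toContinuousLinearMap
    let π' : F →L[ℂ] K := (K.projectionOnto A.range hK.symm).toContinuousLinearMap
    have hππ' : ∀ x y, π x = π y → π' x = π' y → x = y := by
      intro x y h1 h2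
      have h1' : A.range.projection K hK x = A.range.projection K hK y := congrArg Subtype.val h1
      have h2' : K.projection A.range hK.symm x = K.projection A.range hK.symm y :=
        congrArg Subtype.val h2
      rw [← Submodule.projection_add_projection_eq_self hK x, h1', h2',
        Submodule.projection_add_projection_eq_self hK y]
    have hπA : ∀ x, (π (A x) : F) = A x := fun x =>
      Submodule.projection_apply_of_mem_left hK (LinearMap.mem_range_self A.toLinearMap x)
    have hπ'A : ∀ x, π' (A x) = 0 := fun x =>
      Submodule.projectionOnto_apply_of_mem_right hK.symm (LinearMap.mem_range_self A.toLinearMap x)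
    clear_value π π'
    have hker : (π ∘L A).ker = A.ker := by
      ext x
      simp [LinearMap.mem_ker, ← Subtype.coe_inj, hπA]
    obtain ⟨C, hC⟩ := Submodule.exists_isCompl A.ker
    let κ : E →L[ℂ] A.ker := (A.ker.projectionOnto C hC).toContinuousLinearMap
    have hfA : ContDiffAt ℂ 1 f z := contDiffAt_one_of_differentiableOn hU hf hz
    let φ : ImplicitFunctionData ℂ E A.range A.ker :=
      { leftFun := π ∘ f
        leftDeriv := π ∘L A
        rightFun := κ
        rightDeriv := κ
        pt := z
        hasStrictFDerivAt_leftFun :=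
          π.hasStrictFDerivAt.comp z (hfA.hasStrictFDerivAt one_ne_zero)
        hasStrictFDerivAt_rightFun := κ.hasStrictFDerivAt
        range_leftDeriv := by
          rw [LinearMap.range_eq_top]
          rintro ⟨_, x, rfl⟩
          exact ⟨x, Subtype.ext (hπA x)⟩
        range_rightDeriv := Submodule.range_projectionOnto hC
        isCompl_ker := by
          rw [hker]
          convert hC
          exact Submodule.ker_projectionOnto hC }
    let ψ : A.ker → E := φ.implicitFunction (π (f z))
    have hψ : ContDiffAt ℂ 1 ψ (κ z) := by
      have h1 := φ.contDiffAt_implicitFunction (n := 1) (π.contDiff.contDiffAt.comp z hfA)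
        κ.contDiff.contDiffAt one_ne_zero
      exact h1.comp (κ z) (f := fun y : A.ker => (π (f z), y)) (by fun_prop)
    have hψz : ψ (κ z) = z := φ.implicitFunction_apply_image.self_of_nhds
    have hψe : ∀ᶠ y in 𝓝 (κ z), π (f (ψ y)) = π (f z) ∧ κ (ψ y) = y := by
      have h1 : ContinuousAt (fun y : A.ker => (π (f z), y)) (κ z) := by fun_prop
      filter_upwards [h1.eventually φ.prodFun_implicitFunction] with y hy
      exact ⟨congrArg Prod.fst hy, congrArg Prod.snd hy⟩
    have hψd : ∀ᶠ y in 𝓝 (κ z), DifferentiableAt ℂ ψ y ∧ ψ y ∈ U :=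
      ((hψ.eventually (by simp)).mono fun y hy => hy.differentiableAt one_ne_zero).and
        (hψ.continuousAt.eventually (hU.mem_nhds (by rwa [hψz])))
    obtain ⟨r, hr, hball⟩ := Metric.eventually_nhds_iff_ball.1 (hψe.and hψd)
    have hfψ : ∀ y ∈ ball (κ z) r, HasFDerivAt (f ∘ ψ) (fderiv ℂ f (ψ y) ∘L fderiv ℂ ψ y) y :=
      fun y hy => (hf.differentiableAt (hU.mem_nhds (hball y hy).2.2)).hasFDerivAt.comp y
        (hball y hy).2.1.hasFDerivAt
    have hfin := Submodule.finrank_add_eq_of_isCompl hK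
    have hrn := LinearMap.finrank_range_add_finrank_ker A.toLinearMap
    have hpos : 0 < Module.finrank ℂ A.range := by
      rw [Module.finrank_pos_iff, Submodule.nontrivial_iff_ne_bot, ne_eq, LinearMap.range_eq_bot]
      exact fun h => hne (ContinuousLinearMap.coe_inj.1 h)
    have hinj' := ih (Module.finrank ℂ A.ker) (by omega) (E := A.ker) (F := K) (by omega)
      (f := π' ∘ f ∘ ψ) (isOpen_ball (x := κ z) (ε := r))
      (fun y hy => (π'.hasFDerivAt.comp y (hfψ y hy)).differentiableAt.differentiableWithinAt)
      (fun x hx y hy hxy => by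
        have h1 := hππ' (f (ψ x)) (f (ψ y))
          ((hball x hx).1.1.trans (hball y hy).1.1.symm) hxy
        rw [← (hball x hx).1.2, hinj (hball x hx).2.2 (hball y hy).2.2 h1, (hball y hy).1.2])
      (mem_ball_self hr) rfl
    rw [(π'.hasFDerivAt.comp (κ z) (hfψ _ (mem_ball_self hr))).fderiv, hψz] at hinj'
    rw [← ContinuousLinearMap.coe_coe, ← LinearMap.ker_eq_bot, eq_bot_iff]
    intro x hx
    have h0 : (⟨x, hx⟩ : A.ker) = 0 := by
      refine hinj' ?_
      simp only [ContinuousLinearMap.comp_apply, map_zero]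
      exact hπ'A _
    simpa using h0
  exact hrank p hp (fderiv_ne_zero_of_injOn hEF hU hf hinj hrank hp)

end Osgood

/-! ### Images and inverses of injective holomorphic maps -/

section Biholomorphic

variable {E F : Type*} [NormedAddCommGroup E] [NormedSpace ℂ E] [FiniteDimensional ℂ E]
  [NormedAddCommGroup F] [NormedSpace ℂ F] [FiniteDimensional ℂ F]

theorem exists_hasStrictFDerivAt_equiv_of_injOn
    (hEF : Module.finrank ℂ E = Module.finrank ℂ F) {f : E → F} {U : Set E} (hU : IsOpen U)
    (hf : DifferentiableOn ℂ f U) (hinj : InjOn f U) {p : E} (hp : p ∈ U) :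
    ∃ e : E ≃L[ℂ] F, HasStrictFDerivAt f (e : E →L[ℂ] F) p := by
  let e := (LinearMap.linearEquivOfInjective (fderiv ℂ f p).toLinearMap
    (fderiv_injective_of_injOn hEF hU hf hinj hp) hEF).toContinuousLinearEquiv
  refine ⟨e, ?_⟩
  have : (e : E →L[ℂ] F) = fderiv ℂ f p := by
    ext x
    rfl
  rw [this]
  exact (contDiffAt_one_of_differentiableOn hU hf hp).hasStrictFDerivAt one_ne_zero

theorem isOpen_image_of_differentiableOn_of_injOn
    (hEF : Module.finrank ℂ E = Module.finrank ℂ F) {f : E → F} {U : Set E} (hU : IsOpen U)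
    (hf : DifferentiableOn ℂ f U) (hinj : InjOn f U) : IsOpen (f '' U) := by
  have : CompleteSpace E := FiniteDimensional.complete ℂ E
  rw [isOpen_iff_mem_nhds]
  rintro _ ⟨p, hp, rfl⟩
  obtain ⟨e, he⟩ := exists_hasStrictFDerivAt_equiv_of_injOn hEF hU hf hinj hp
  rw [← he.map_nhds_eq_of_equiv]
  exact image_mem_map (hU.mem_nhds hp)

theorem differentiableOn_image_of_leftInvOn
    (hEF : Module.finrank ℂ E = Module.finrank ℂ F) {f : E → F} {U : Set E} (hU : IsOpen U)
    (hf : DifferentiableOn ℂ f U) {g : F → E} (hg : LeftInvOn g f U) :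
    DifferentiableOn ℂ g (f '' U) := by
  have : CompleteSpace E := FiniteDimensional.complete ℂ E
  rintro _ ⟨p, hp, rfl⟩
  obtain ⟨e, he⟩ := exists_hasStrictFDerivAt_equiv_of_injOn hEF hU hf hg.injOn hp
  exact (he.to_local_left_inverse ((hU.eventually_mem hp).mono fun x hx =>
    hg hx)).hasFDerivAt.differentiableAt.differentiableWithinAt

end Biholomorphic

/-! ### Estimates near the origin and a covering theorem -/

section Quantitative

variable {E F : Type*} [NormedAddCommGroup E] [NormedSpace ℂ E]
  [NormedAddCommGroup F] [NormedSpace ℂ F]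

/-- A map bounded by `M` on a ball is Lipschitz on the concentric ball of half the radius. -/
theorem norm_sub_le_of_forall_norm_le {G : E → F} {ρ σ M : ℝ} (hσρ : σ < ρ)
    (hG : DifferentiableOn ℂ G (ball 0 ρ)) (hM : ∀ z ∈ ball 0 ρ, ‖G z‖ ≤ M) {x y : E}
    (hx : ‖x‖ ≤ σ) (hy : ‖y‖ ≤ σ) : ‖G x - G y‖ ≤ 2 * M / (ρ - σ) * ‖x - y‖ := by
  have hsub : ∀ z ∈ closedBall (0 : E) σ, ball z (ρ - σ) ⊆ ball 0 ρ := fun z hz =>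
    ball_subset_ball' (by rw [mem_closedBall] at hz; linarith)
  refine (convex_closedBall (0 : E) σ).norm_image_sub_le_of_norm_fderiv_le (𝕜 := ℂ) (fun z hz => ?_)
    (fun z hz => ?_) (by simpa using hy) (by simpa using hx)
  · exact hG.differentiableAt
      (isOpen_ball.mem_nhds (hsub z hz (mem_ball_self (by linarith))))
  · exact norm_fderiv_le_of_forall_norm_le (by linarith) (hG.mono (hsub z hz))
      fun w hw => hM w (hsub z hz hw)

/-- If moreover the derivative at the origin vanishes, the Lipschitz constant tends to zero linearly
with the radius. -/
theorem norm_sub_le_of_fderiv_zero_eq_zero [FiniteDimensional ℂ E] [CompleteSpace F] {G : E → F}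
    {ρ σ M : ℝ} (hσ : σ < ρ / 2) (hG : DifferentiableOn ℂ G (ball 0 ρ))
    (hM : ∀ z ∈ ball 0 ρ, ‖G z‖ ≤ M) (h0 : HasFDerivAt G (0 : E →L[ℂ] F) 0) {x y : E}
    (hx : ‖x‖ ≤ σ) (hy : ‖y‖ ≤ σ) : ‖G x - G y‖ ≤ 8 * M / ρ ^ 2 * σ * ‖x - y‖ := by
  have hσ0 : 0 ≤ σ := (norm_nonneg x).trans hx
  have hρ : 0 < ρ := by linarith
  have hM0 : 0 ≤ M := (norm_nonneg _).trans (hM 0 (mem_ball_self hρ))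
  have hsub : ball (0 : E) (ρ / 2) ⊆ ball 0 ρ := ball_subset_ball (by linarith)
  have hd : ∀ z ∈ ball (0 : E) (ρ / 2), ‖fderiv ℂ G z‖ ≤ 4 * M / ρ := by
    intro z hz
    have hs : ball z (ρ / 2) ⊆ ball 0 ρ :=
      ball_subset_ball' (by rw [mem_ball] at hz; linarith)
    refine (norm_fderiv_le_of_forall_norm_le (half_pos hρ) (hG.mono hs)
      fun w hw => hM w (hs hw)).trans_eq ?_
    field_simp
    ring
  have hd' : ∀ z ∈ ball (0 : E) (ρ / 2), ‖fderiv ℂ G z‖ ≤ 8 * M / ρ ^ 2 * ‖z‖ := by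
    intro z hz
    have h := Complex.dist_le_div_mul_dist_of_mapsTo_ball
      ((differentiableOn_fderiv isOpen_ball hG).mono hsub) (R₂ := 4 * M / ρ)
      (fun w hw => by simpa [h0.fderiv] using hd w hw) hz
    rw [h0.fderiv, dist_zero_right, dist_zero_right] at h
    refine h.trans_eq ?_
    field_simp
    ring
  have hcb : closedBall (0 : E) σ ⊆ ball 0 (ρ / 2) := closedBall_subset_ball hσ
  refine (convex_closedBall (0 : E) σ).norm_image_sub_le_of_norm_fderiv_le (𝕜 := ℂ) (fun z hz => ?_)
    (fun z hz => ?_) (by simpa using hy) (by simpa using hx)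
  · exact hG.differentiableAt (isOpen_ball.mem_nhds (hsub (hcb hz)))
  · refine (hd' z (hcb hz)).trans ?_
    gcongr
    simpa using hz

/-- A weak form of the Koebe covering theorem in several variables. -/
theorem ball_subset_image_of_forall_norm_le [FiniteDimensional ℂ E] {G : E → E} {ρ M : ℝ}
    (hρ : 0 < ρ) (hG : DifferentiableOn ℂ G (ball 0 ρ)) (hM : ∀ z ∈ ball 0 ρ, ‖G z‖ ≤ M)
    (hG0 : G 0 = 0) (hG' : HasFDerivAt G (ContinuousLinearMap.id ℂ E) 0) :
    ball 0 (ρ ^ 2 / (32 * (M + ρ))) ⊆ G '' ball 0 ρ := by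
  have : CompleteSpace E := FiniteDimensional.complete ℂ E
  have hM0 : 0 ≤ M := (norm_nonneg _).trans (hM 0 (mem_ball_self hρ))
  have hMρ : 0 < M + ρ := by linarith
  set σ := ρ ^ 2 / (16 * (M + ρ)) with hσ
  have hσ0 : 0 < σ := by positivity
  have hσρ : σ < ρ / 2 := by
    rw [hσ, div_lt_div_iff₀ (by positivity) (by positivity)]
    nlinarith
  have happ : ApproximatesLinearOn G (ContinuousLinearMap.id ℂ E) (closedBall 0 σ) (1 / 2) := by
    intro x hx y hy
    have h := norm_sub_le_of_fderiv_zero_eq_zero (G := fun z => G z - z) (M := M + ρ) hσρ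
      (hG.sub differentiableOn_id) (fun z hz => (norm_sub_le _ _).trans
        (add_le_add (hM z hz) (by simpa using (mem_ball.1 hz).le)))
      (sub_self (ContinuousLinearMap.id ℂ E) ▸ hG'.sub (hasFDerivAt_id 0))
      (by simpa using hx) (by simpa using hy)
    have hc : 8 * (M + ρ) / ρ ^ 2 * σ = 1 / 2 := by
      rw [hσ]
      field_simp
      norm_num
    rw [hc] at h
    simpa [sub_sub_sub_comm] using h
  let inv : (ContinuousLinearMap.id ℂ E).NonlinearRightInverse :=
    { toFun := id
      nnnorm := 1
      bound' := by simp
      right_inv' := by simp }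
  have hsurj := happ.surjOn_closedBall_of_nonlinearRightInverse inv hσ0.le subset_rfl
  rw [hG0] at hsurj
  intro y hy
  have hy' : y ∈ closedBall (0 : E) (((inv.nnnorm : ℝ)⁻¹ - (1 / 2 : NNReal)) * σ) := by
    rw [mem_closedBall]
    refine (mem_ball.1 hy).le.trans_eq ?_
    simp only [inv, hσ]
    push_cast
    field_simp
    norm_num
  obtain ⟨x, hx, rfl⟩ := hsurj hy'
  exact ⟨x, closedBall_subset_ball (by linarith) hx, rfl⟩

end Quantitative

/-! ### Self-maps of the ball close to the identity -/

section Caratheodory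

variable {E : Type*} [NormedAddCommGroup E] [InnerProductSpace ℂ E]

open scoped InnerProductSpace ComplexConjugate

/-- On complex lines through the origin, the function `1 - ⟪u, φ (ζ u)⟫ / ζ` has nonnegative real
part, so that it is controlled by its value `1 - c` at the origin. -/
theorem norm_inner_self_sub_le {φ : E → E} (hφ : DifferentiableOn ℂ φ (ball 0 1))
    (hmaps : MapsTo φ (ball 0 1) (ball 0 1)) (h0 : φ 0 = 0) {c : ℝ} (hc : c ≤ 1)
    (hd : HasFDerivAt φ ((c : ℂ) • ContinuousLinearMap.id ℂ E) 0) {y : E} (hy : ‖y‖ < 1) :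
    ‖⟪y, y - φ y⟫_ℂ‖ ≤ 2 * (1 - c) / (1 - ‖y‖) := by
  have hy1 : 0 < 1 - ‖y‖ := by linarith
  rcases eq_or_ne y 0 with rfl | hy0
  · simp [h0, hc]
  have hny : 0 < ‖y‖ := norm_pos_iff.2 hy0
  set u : E := ((‖y‖⁻¹ : ℝ) : ℂ) • y with hu
  have hu1 : ‖u‖ = 1 := by
    rw [hu, norm_smul, Complex.norm_real, norm_inv, norm_norm, inv_mul_cancel₀ hny.ne']
  have hyu : y = (‖y‖ : ℂ) • u := by
    rw [hu, smul_smul, ← Complex.ofReal_mul, mul_inv_cancel₀ hny.ne']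
    simp
  have hline : MapsTo (fun ζ : ℂ => ζ • u) (ball 0 1) (ball 0 1) := fun ζ hζ => by
    simpa [norm_smul, hu1] using hζ
  set b : ℂ → ℂ := fun ζ => ⟪u, φ (ζ • u)⟫_ℂ with hb
  have hbd : DifferentiableOn ℂ b (ball 0 1) :=
    (innerSL ℂ u).differentiable.comp_differentiableOn
      (hφ.comp (by fun_prop : Differentiable ℂ fun ζ : ℂ => ζ • u).differentiableOn hline)
  have hb0 : b 0 = 0 := by simp [hb, h0]
  have hbm : MapsTo b (ball 0 1) (closedBall (b 0) 1) := by
    intro ζ hζ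
    rw [hb0, mem_closedBall, dist_zero_right]
    refine (norm_inner_le_norm _ _).trans ?_
    rw [hu1, one_mul]
    simpa using (mem_ball.1 (hmaps (hline hζ))).le
  have hb' : deriv b 0 = c := by
    have h1 : HasDerivAt (fun ζ : ℂ => ζ • u) u 0 := by
      simpa using (hasDerivAt_id (0 : ℂ)).smul_const u
    have h2 : HasFDerivAt φ ((c : ℂ) • ContinuousLinearMap.id ℂ E) ((0 : ℂ) • u) := by
      simpa using hd
    have h3 := ((innerSL ℂ u).hasFDerivAt.comp_hasDerivAt (0 : ℂ) (h2.comp_hasDerivAt 0 h1)).deriv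
    have h4 : deriv b 0 = ⟪u, (c : ℂ) • u⟫_ℂ := by simpa [Function.comp_def] using h3
    rw [h4, inner_smul_right, inner_self_eq_norm_sq_to_K, hu1]
    simp
  set p : ℂ → ℂ := fun ζ => dslope b 0 ζ - 1 with hp
  have hpd : DifferentiableOn ℂ p (ball 0 1) :=
    ((Complex.differentiableOn_dslope (ball_mem_nhds 0 one_pos)).2 hbd).sub_const 1
  have hpre : ∀ ζ ∈ ball (0 : ℂ) 1, (p ζ).re ≤ 0 := by
    intro ζ hζ
    have h1 := Complex.norm_dslope_le_div_of_mapsTo_ball hbd hbm hζ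
    have h2 := (Complex.re_le_norm _).trans h1
    simp only [hp, Complex.sub_re, Complex.one_re]
    linarith
  have hp0 : ‖p 0‖ = 1 - c := by
    simp only [hp, dslope_same, hb']
    rw [← Complex.ofReal_one, ← Complex.ofReal_sub, Complex.norm_real, Real.norm_eq_abs,
      abs_of_nonpos (by linarith)]
    ring
  have hyball : (‖y‖ : ℂ) ∈ ball (0 : ℂ) 1 := by simpa using hy
  have hpy : ‖p ‖y‖‖ ≤ (1 - c) * (1 + ‖y‖) / (1 - ‖y‖) := by
    refine le_of_forall_pos_le_add fun ε hε => ?_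
    have := Complex.borelCaratheodory (M := ε * (1 - ‖y‖) / (2 * ‖y‖)) (by positivity) hpd
      (fun ζ hζ => (hpre ζ hζ).trans (by positivity)) one_pos hyball
    rw [hp0, Complex.norm_real, norm_norm] at this
    refine this.trans_eq ?_
    field_simp
    ring
  have hkey : ⟪y, y - φ y⟫_ℂ = -(‖y‖ ^ 2 : ℂ) * p ‖y‖ := by
    have hne : (‖y‖ : ℂ) ≠ 0 := by exact_mod_cast hny.ne'
    have h1 : ⟪y, φ y⟫_ℂ = ‖y‖ * b ‖y‖ := by
      conv_lhs => rw [hyu]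
      rw [inner_smul_left, Complex.conj_ofReal]
    rw [inner_sub_right, inner_self_eq_norm_sq_to_K, h1, hp]
    simp only [dslope_of_ne b hne, slope_def_field, hb0, sub_zero]
    simp only [Complex.coe_algebraMap]
    field_simp
    ring
  rw [hkey, norm_mul, norm_neg, norm_pow, Complex.norm_real, norm_norm]
  calc ‖y‖ ^ 2 * ‖p ‖y‖‖ ≤ 1 * ((1 - c) * (1 + ‖y‖) / (1 - ‖y‖)) := by
        gcongr
        exact pow_le_one₀ hny.le hy.le
    _ ≤ 2 * (1 - c) / (1 - ‖y‖) := by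
        rw [one_mul]
        refine div_le_div_of_nonneg_right ?_ hy1.le
        nlinarith [mul_nonneg (sub_nonneg.2 hc) hy1.le]

/-- A self-map of the ball fixing the origin with derivative `c • id` there differs from the identity
by `O(1 - c)`, locally uniformly. The estimate for the radial component `⟪y, y - φ y⟫` is turned
into one for all components `⟪w, z - φ z⟫`, by the maximum principle for the holomorphic function
`ζ ↦ ⟪w, h (z + ζ w)⟫ + ζ ⟪z, h (z + ζ w)⟫` with `h = id - φ`, which on the unit circle equals
`ζ ⟪z + ζ w, h (z + ζ w)⟫`. -/
theorem norm_self_sub_le {φ : E → E} (hφ : DifferentiableOn ℂ φ (ball 0 1))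
    (hmaps : MapsTo φ (ball 0 1) (ball 0 1)) (h0 : φ 0 = 0) {c : ℝ} (hc : c ≤ 1)
    (hd : HasFDerivAt φ ((c : ℂ) • ContinuousLinearMap.id ℂ E) 0) {r : ℝ} (hr : r < 1) {z : E}
    (hz : ‖z‖ ≤ r) : ‖z - φ z‖ ≤ 8 * (1 - c) / (1 - r) ^ 2 := by
  have hr1 : 0 < 1 - r := by linarith
  set h : E → E := fun y => y - φ y with hh
  have hhd : DifferentiableOn ℂ h (ball 0 1) := differentiableOn_id.sub hφ
  rcases eq_or_ne (h z) 0 with h0z | h0z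
  · change ‖h z‖ ≤ _
    rw [h0z, norm_zero]
    have : 0 ≤ 1 - c := by linarith
    positivity
  have hnz : 0 < ‖h z‖ := norm_pos_iff.2 h0z
  set w : E := (((1 - r) / 2 / ‖h z‖ : ℝ) : ℂ) • h z with hw
  have hwn : ‖w‖ = (1 - r) / 2 := by
    rw [hw, norm_smul, Complex.norm_real, Real.norm_eq_abs, abs_of_pos (by positivity)]
    field_simp
  have hbd : ∀ ζ : ℂ, ‖ζ‖ ≤ 1 → ‖z + ζ • w‖ ≤ (1 + r) / 2 := by
    intro ζ hζ
    calc ‖z + ζ • w‖ ≤ ‖z‖ + ‖ζ‖ * ‖w‖ := (norm_add_le _ _).trans (by rw [norm_smul])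
      _ ≤ r + 1 * ((1 - r) / 2) := by rw [hwn]; gcongr
      _ = (1 + r) / 2 := by ring
  set k : ℂ → ℂ := fun ζ => ⟪w, h (z + ζ • w)⟫_ℂ + ζ * ⟪z, h (z + ζ • w)⟫_ℂ with hk
  have hhl : ∀ ζ ∈ closedBall (0 : ℂ) 1, DifferentiableAt ℂ (fun ζ : ℂ => h (z + ζ • w)) ζ := by
    intro ζ hζ
    have hmem : z + ζ • w ∈ ball (0 : E) 1 := by
      rw [mem_ball, dist_zero_right]
      exact (hbd ζ (by simpa using hζ)).trans_lt (by linarith)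
    exact (hhd.differentiableAt (isOpen_ball.mem_nhds hmem)).comp ζ
      (f := fun ζ : ℂ => z + ζ • w) (by fun_prop)
  have hkd : DiffContOnCl ℂ k (ball 0 1) := by
    refine DifferentiableOn.diffContOnCl ?_
    rw [closure_ball _ one_ne_zero]
    intro ζ hζ
    refine DifferentiableAt.differentiableWithinAt ?_
    exact ((innerSL ℂ w).differentiableAt.comp ζ (hhl ζ hζ)).add
      (differentiableAt_id.mul ((innerSL ℂ z).differentiableAt.comp ζ (hhl ζ hζ)))
  have hmax := Complex.norm_le_of_forall_mem_frontier_norm_le isBounded_ball hkd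
    (C := 4 * (1 - c) / (1 - r)) (fun ζ hζ => ?_) (subset_closure (mem_ball_self one_pos))
  · have hk0 : k 0 = ⟪w, h z⟫_ℂ := by simp [hk]
    rw [hk0, hw, inner_smul_left, Complex.conj_ofReal, inner_self_eq_norm_sq_to_K, norm_mul,
      Complex.norm_real, norm_pow] at hmax
    simp only [Complex.coe_algebraMap, Complex.norm_real, Real.norm_eq_abs, abs_norm] at hmax
    rw [abs_of_pos (by positivity)] at hmax
    change ‖h z‖ ≤ _
    rw [le_div_iff₀ hr1] at hmax
    rw [le_div_iff₀ (by positivity)]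
    field_simp at hmax
    linarith
  · rw [frontier_ball _ one_ne_zero, mem_sphere, dist_zero_right] at hζ
    have hζζ : ζ * conj ζ = 1 := by
      rw [Complex.mul_conj, Complex.normSq_eq_norm_sq, hζ]
      simp
    have hkζ : k ζ = ζ * ⟪z + ζ • w, h (z + ζ • w)⟫_ℂ := by
      rw [inner_add_left, inner_smul_left, mul_add, ← mul_assoc, hζζ, one_mul, add_comm]
    have hle := hbd ζ hζ.le
    rw [hkζ, norm_mul, hζ, one_mul]
    refine (norm_inner_self_sub_le hφ hmaps h0 hc hd (by linarith)).trans ?_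
    rw [div_le_div_iff₀ (by linarith) hr1]
    nlinarith

end Caratheodory

/-! ### Transition maps and regularity in time -/

section Transition

variable {n : ℕ}

/-- The transition map `φ_{s,t} = f_t⁻¹ ∘ f_s` of a family `f`, through an arbitrary inverse of
`f t` on the unit ball. -/
noncomputable def loewnerTransition (f : ℝ → CSpace n → CSpace n) (s t : ℝ) :
    CSpace n → CSpace n :=
  fun z => Function.invFunOn (f t) (unitBall n) (f s z)

variable {f : ℝ → CSpace n → CSpace n} {s t u : ℝ} {z : CSpace n}

theorem isOpen_unitBall (n : ℕ) : IsOpen (unitBall n) := isOpen_ball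

theorem zero_mem_unitBall (n : ℕ) : (0 : CSpace n) ∈ unitBall n := mem_ball_self one_pos

theorem mem_unitBall_iff : z ∈ unitBall n ↔ ‖z‖ < 1 := mem_ball_zero_iff

theorem IsSubordinationChain.isOpen_image (hf : IsSubordinationChain f) (ht : 0 ≤ t)
    {V : Set (CSpace n)} (hV : IsOpen V) (hVB : V ⊆ unitBall n) : IsOpen (f t '' V) :=
  isOpen_image_of_differentiableOn_of_injOn rfl hV ((hf.univalent t ht).1.mono hVB)
    ((hf.univalent t ht).2.mono hVB)

theorem IsSubordinationChain.differentiableOn_invFunOn (hf : IsSubordinationChain f)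
    (ht : 0 ≤ t) :
    DifferentiableOn ℂ (Function.invFunOn (f t) (unitBall n)) (f t '' unitBall n) :=
  differentiableOn_image_of_leftInvOn rfl (isOpen_unitBall n) (hf.univalent t ht).1
    (hf.univalent t ht).2.leftInvOn_invFunOn

theorem IsSubordinationChain.mapsTo_transition (hf : IsSubordinationChain f) (hs : 0 ≤ s)
    (hst : s ≤ t) : MapsTo (loewnerTransition f s t) (unitBall n) (unitBall n) := fun _ hz =>
  Function.invFunOn_mem (hf.subset s t hs hst (mem_image_of_mem _ hz))

theorem IsSubordinationChain.apply_transition (hf : IsSubordinationChain f) (hs : 0 ≤ s)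
    (hst : s ≤ t) (hz : z ∈ unitBall n) : f t (loewnerTransition f s t z) = f s z :=
  Function.invFunOn_eq (hf.subset s t hs hst (mem_image_of_mem _ hz))

theorem IsSubordinationChain.transition_transition (hf : IsSubordinationChain f) (hs : 0 ≤ s)
    (hst : s ≤ t) (hz : z ∈ unitBall n) :
    loewnerTransition f t u (loewnerTransition f s t z) = loewnerTransition f s u z := by
  rw [loewnerTransition, hf.apply_transition hs hst hz, loewnerTransition]

theorem IsSubordinationChain.differentiableOn_transition (hf : IsSubordinationChain f)
    (hs : 0 ≤ s) (hst : s ≤ t) :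
    DifferentiableOn ℂ (loewnerTransition f s t) (unitBall n) :=
  (hf.differentiableOn_invFunOn (hs.trans hst)).comp (hf.univalent s hs).1 fun _ hz =>
    hf.subset s t hs hst (mem_image_of_mem _ hz)

theorem IsNormalizedLoewnerChain.transition_zero (hf : IsNormalizedLoewnerChain f) (hs : 0 ≤ s)
    (hst : s ≤ t) : loewnerTransition f s t 0 = 0 := by
  refine (hf.univalent t (hs.trans hst)).2
    (hf.mapsTo_transition hs hst (zero_mem_unitBall n)) (zero_mem_unitBall n) ?_
  rw [hf.apply_transition hs hst (zero_mem_unitBall n), hf.map_zero s hs,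
    hf.map_zero t (hs.trans hst)]

theorem IsNormalizedLoewnerChain.hasFDerivAt_transition (hf : IsNormalizedLoewnerChain f)
    (hs : 0 ≤ s) (hst : s ≤ t) :
    HasFDerivAt (loewnerTransition f s t)
      ((Real.exp (s - t) : ℂ) • ContinuousLinearMap.id ℂ (CSpace n)) 0 := by
  have hB : unitBall n ∈ 𝓝 (0 : CSpace n) := (isOpen_unitBall n).mem_nhds (zero_mem_unitBall n)
  have hd := ((hf.differentiableOn_transition hs hst).differentiableAt hB).hasFDerivAt
  have ht := hf.hasFDerivAt_zero t (hs.trans hst)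
  rw [← hf.transition_zero hs hst] at ht
  have heq : f t ∘ loewnerTransition f s t =ᶠ[𝓝 0] f s := by
    filter_upwards [hB] with z hz
    exact hf.apply_transition hs hst hz
  have hcomp := ((ht.comp 0 hd).congr_of_eventuallyEq heq.symm).unique (hf.hasFDerivAt_zero s hs)
  convert hd using 1
  rw [ContinuousLinearMap.smul_comp, ContinuousLinearMap.id_comp] at hcomp
  have hexp : (Real.exp (s - t) : ℂ) = (Real.exp t : ℂ)⁻¹ * (Real.exp s : ℂ) := by
    rw [Real.exp_sub]
    push_cast
    field_simp
  rw [hexp, mul_smul, ← hcomp, inv_smul_smul₀]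
  exact_mod_cast (Real.exp_pos t).ne'

theorem IsNormalizedLoewnerChain.norm_transition_le (hf : IsNormalizedLoewnerChain f)
    (hs : 0 ≤ s) (hst : s ≤ t) (hz : z ∈ unitBall n) : ‖loewnerTransition f s t z‖ ≤ ‖z‖ :=
  Complex.norm_le_norm_of_mapsTo_ball (hf.differentiableOn_transition hs hst)
    ((hf.mapsTo_transition hs hst).mono_right ball_subset_closedBall)
    (hf.transition_zero hs hst) (mem_unitBall_iff.1 hz)

/-- A normalized Loewner chain is locally Lipschitz in time, locally uniformly on the ball. -/
theorem IsNormalizedLoewnerChain.exists_norm_sub_le (hf : IsNormalizedLoewnerChain f) {T r : ℝ}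
    (hT : 0 ≤ T) (hr0 : 0 ≤ r) (hr : r < 1) :
    ∃ L, 0 ≤ L ∧ ∀ s t, 0 ≤ s → s ≤ t → t ≤ T → ∀ z : CSpace n, ‖z‖ ≤ r →
      ‖f s z - f t z‖ ≤ L * (t - s) := by
  set ρ := (1 + r) / 2 with hρ
  have hρr : r < ρ := by linarith
  have hρ1 : ρ < 1 := by linarith
  have hsub : closedBall (0 : CSpace n) ρ ⊆ unitBall n := closedBall_subset_ball hρ1
  obtain ⟨M, hM⟩ := (isCompact_closedBall (0 : CSpace n) ρ).exists_bound_of_continuousOn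
    ((hf.univalent T hT).1.continuousOn.mono hsub)
  have hM0 : 0 ≤ M := (norm_nonneg _).trans (hM 0 (mem_closedBall_self (by linarith)))
  have hrρ : 0 < ρ - r := by linarith
  have hr1 : 0 < 1 - r := by linarith
  refine ⟨2 * M / (ρ - r) * (8 / (1 - r) ^ 2), by positivity, fun s t hs hst htT z hz => ?_⟩
  have ht := hs.trans hst
  have hzB : z ∈ unitBall n := mem_unitBall_iff.2 (hz.trans_lt hr)
  have hMt : ∀ y ∈ ball (0 : CSpace n) ρ, ‖f t y‖ ≤ M := by
    intro y hy
    have hyB := hsub (ball_subset_closedBall hy)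
    rw [← hf.apply_transition ht htT hyB]
    refine hM _ ?_
    rw [mem_closedBall, dist_zero_right]
    exact (hf.norm_transition_le ht htT hyB).trans (by simpa using (mem_ball.1 hy).le)
  rw [← hf.apply_transition hs hst hzB]
  refine (norm_sub_le_of_forall_norm_le hρr ((hf.univalent t ht).1.mono
    (ball_subset_closedBall.trans hsub)) hMt ((hf.norm_transition_le hs hst hzB).trans hz)
    hz).trans ?_
  rw [mul_assoc]
  gcongr
  rw [norm_sub_rev]
  refine (norm_self_sub_le (hf.differentiableOn_transition hs hst)
    (hf.mapsTo_transition hs hst) (hf.transition_zero hs hst)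
    (Real.exp_le_one_iff.2 (sub_nonpos.2 hst)) (hf.hasFDerivAt_transition hs hst) hr hz).trans ?_
  rw [div_mul_eq_mul_div]
  refine div_le_div_of_nonneg_right ?_ (by positivity)
  linarith [Real.add_one_le_exp (s - t)]

/-- The argument is shifted to `ζ + 1` because `ℓ t` must be bounded by the integrand on all of
`[s, t]`, which monotonicity gives for intervals of length at most one; these are then summed. -/
theorem norm_sub_le_integral_of_le_mul {E : Type*} [NormedAddCommGroup E] {g : ℝ → E} {ℓ : ℝ → ℝ}
    (hℓ : Monotone ℓ) (hg : ∀ s t, 0 ≤ s → s ≤ t → ‖g s - g t‖ ≤ ℓ t * (t - s)) (hs : 0 ≤ s)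
    (hst : s ≤ t) : ‖g s - g t‖ ≤ ∫ ζ in s..t, ℓ (ζ + 1) := by
  have hmono : Monotone fun ζ => ℓ (ζ + 1) := fun a b hab => hℓ (by linarith)
  have hint : ∀ a b, IntervalIntegrable (fun ζ => ℓ (ζ + 1)) MeasureTheory.volume a b :=
    fun a b => hmono.intervalIntegrable
  have hshort : ∀ a b, 0 ≤ a → a ≤ b → b ≤ a + 1 →
      ‖g a - g b‖ ≤ ∫ ζ in a..b, ℓ (ζ + 1) := by
    intro a b ha hab hba
    refine (hg a b ha hab).trans ?_
    have := intervalIntegral.integral_mono_on hab (f := fun _ => ℓ b) (by simp) (hint a b)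
      fun x hx => hℓ (by linarith [hx.1])
    simpa [mul_comm] using this
  have hlong : ∀ m : ℕ, ∀ a b : ℝ, 0 ≤ a → a ≤ b → b ≤ a + m + 1 →
      ‖g a - g b‖ ≤ ∫ ζ in a..b, ℓ (ζ + 1) := by
    intro m
    induction m with
    | zero => exact fun a b ha hab hba => hshort a b ha hab (by simpa using hba)
    | succ m ih =>
      intro a b ha hab hba
      push_cast at hba
      rcases le_total b (a + 1) with h | h
      · exact hshort a b ha hab h
      · rw [← intervalIntegral.integral_add_adjacent_intervals (hint a (a + 1)) (hint (a + 1) b)]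
        calc ‖g a - g b‖ ≤ ‖g a - g (a + 1)‖ + ‖g (a + 1) - g b‖ :=
              norm_sub_le_norm_sub_add_norm_sub ..
          _ ≤ _ := add_le_add (hshort a (a + 1) ha (by linarith) le_rfl)
            (ih (a + 1) b (by linarith) h (by linarith))
  obtain ⟨m, hm⟩ := exists_nat_ge (t - s)
  exact hlong m s t hs hst (by linarith)

theorem IsNormalizedLoewnerChain.isLoewnerChainOfOrder_top (hf : IsNormalizedLoewnerChain f) :
    IsLoewnerChainOfOrder ∞ f := by
  refine ⟨hf.toIsSubordinationChain, le_top, fun K hK hKB => ?_⟩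
  obtain ⟨r, hr, hKr⟩ := exists_lt_subset_ball hK.isClosed hKB
  have hr' : max r 0 < 1 := max_lt hr one_pos
  choose L hL0 hL using fun N : ℕ => hf.exists_norm_sub_le (T := N) N.cast_nonneg
    (le_max_right r 0) hr'
  set ℓ : ℝ → ℝ := fun t => ∑ i ∈ Finset.range (⌈t⌉₊ + 1), L i with hℓ
  have hℓm : Monotone ℓ := fun a b hab =>
    Finset.sum_le_sum_of_subset_of_nonneg
      (Finset.range_mono (Nat.add_le_add_right (Nat.ceil_mono hab) 1)) fun i _ _ => hL0 i
  have hℓ0 : ∀ t, 0 ≤ ℓ t := fun t => Finset.sum_nonneg fun i _ => hL0 i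
  have hLℓ : ∀ t, L ⌈t⌉₊ ≤ ℓ t := fun t =>
    Finset.single_le_sum (f := L) (fun i _ => hL0 i) (Finset.self_mem_range_succ _)
  have hkm : Monotone fun ζ => ℓ (ζ + 1) := fun a b hab => hℓm (by linarith)
  refine ⟨fun ζ => ℓ (ζ + 1), ⟨fun ζ _ => hℓ0 _, fun T _ => ?_⟩, fun z hz s t hs hst => ?_⟩
  · refine MeasureTheory.memLp_top_of_bound hkm.measurable.aestronglyMeasurable (ℓ (T + 1)) ?_
    refine MeasureTheory.ae_restrict_of_forall_mem measurableSet_Icc fun ζ hζ => ?_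
    rw [Real.norm_of_nonneg (hℓ0 _)]
    exact hkm hζ.2
  · refine norm_sub_le_integral_of_le_mul (g := fun t => f t z) hℓm (fun a b ha hab => ?_) hs hst
    have hzr : ‖z‖ ≤ max r 0 := by
      have := hKr hz
      rw [mem_ball_zero_iff] at this
      exact this.le.trans (le_max_left _ _)
    refine (hL ⌈b⌉₊ a b ha hab (Nat.le_ceil b) z hzr).trans ?_
    exact mul_le_mul_of_nonneg_right (hLℓ b) (sub_nonneg.2 hab)

end Transition

/-! ### The limit of the rescaled inverses -/

section Limit

variable {n : ℕ} {f : ℝ → CSpace n → CSpace n} {s t : ℝ} {z : CSpace n}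

/-- The second order Schwarz lemma for `z ↦ φ_{s,t}(z) - e^{s-t} z`. -/
theorem IsNormalizedLoewnerChain.norm_transition_sub_le (hf : IsNormalizedLoewnerChain f)
    (hs : 0 ≤ s) (hst : s ≤ t) (hz : z ∈ unitBall n) :
    ‖loewnerTransition f s t z - (Real.exp (s - t) : ℂ) • z‖
      ≤ (1 + Real.exp (s - t)) * ‖z‖ ^ 2 := by
  have h0 := hf.transition_zero hs hst
  have key := Complex.dist_le_mul_div_pow_of_mapsTo_ball_of_isLittleO (n := 1)
    (f := fun z => loewnerTransition f s t z - (Real.exp (s - t) : ℂ) • z) (c := 0) (R₁ := 1)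
    (R₂ := 1 + Real.exp (s - t)) (z := z) ?_ ?_ ?_ hz
  · simpa [h0] using key
  · exact (hf.differentiableOn_transition hs hst).sub (by fun_prop)
  · intro y hy
    have hy' : ‖y‖ < 1 := mem_ball_zero_iff.1 hy
    simp only [h0, smul_zero, sub_zero, mem_closedBall, dist_zero_right]
    refine (norm_sub_le _ _).trans (add_le_add
      (mem_unitBall_iff.1 (hf.mapsTo_transition hs hst hy)).le ?_)
    rw [norm_smul, Complex.norm_real, Real.norm_of_nonneg (Real.exp_nonneg _)]
    exact mul_le_of_le_one_right (Real.exp_nonneg _) hy'.le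
  · simpa [h0] using (hf.hasFDerivAt_transition hs hst).isLittleO.norm_right

theorem IsNormalizedLoewnerChain.norm_exp_smul_transition_one_sub_le
    (hf : IsNormalizedLoewnerChain f) (ht : 0 ≤ t) (hz : z ∈ unitBall n) :
    ‖(Real.exp 1 : ℂ) • loewnerTransition f t (t + 1) z - z‖ ≤ 6 * ‖z‖ ^ 2 := by
  have h := hf.norm_transition_sub_le ht (by linarith : t ≤ t + 1) hz
  have hexp : t - (t + 1) = -1 := by ring
  rw [hexp] at h
  have h1 : (Real.exp 1 : ℂ) * (Real.exp (-1) : ℂ) = 1 := by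
    rw [← Complex.ofReal_mul, ← Real.exp_add]
    simp
  have h2 : (Real.exp 1 : ℂ) • loewnerTransition f t (t + 1) z - z = (Real.exp 1 : ℂ) •
      (loewnerTransition f t (t + 1) z - (Real.exp (-1) : ℂ) • z) := by
    rw [smul_sub, smul_smul, h1, one_smul]
  rw [h2, norm_smul, Complex.norm_real, Real.norm_of_nonneg (Real.exp_nonneg _)]
  have h3 : Real.exp (-1) ≤ 1 := Real.exp_le_one_iff.2 (by norm_num)
  have h4 : Real.exp 1 ≤ 3 := Real.exp_one_lt_three.le
  calc Real.exp 1 * ‖loewnerTransition f t (t + 1) z - (Real.exp (-1) : ℂ) • z‖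
      ≤ 3 * ((1 + 1) * ‖z‖ ^ 2) := by
        gcongr
        exact h.trans (by gcongr)
    _ = 6 * ‖z‖ ^ 2 := by ring

/-- Near the origin the rescaled transition maps `e^j φ_{t,t+j}` stay bounded: the product of the
errors of the successive steps converges. -/
theorem IsNormalizedLoewnerChain.exp_mul_norm_transition_le (hf : IsNormalizedLoewnerChain f)
    (ht : 0 ≤ t) (hz : ‖z‖ ≤ 1 / 48) (j : ℕ) :
    Real.exp j * ‖loewnerTransition f t (t + j) z‖ ≤ (2 - (1 / 2) ^ j) * ‖z‖ ∧
    ‖(Real.exp (j + 1) : ℂ) • loewnerTransition f t (t + j + 1) z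
      - (Real.exp j : ℂ) • loewnerTransition f t (t + j) z‖ ≤ (1 / 2) ^ j * ‖z‖ / 2 := by
  have hzB : z ∈ unitBall n := mem_unitBall_iff.2 (by linarith)
  have hj : ∀ j : ℕ, t ≤ t + j := fun j => by simp
  have hmem : ∀ j : ℕ, loewnerTransition f t (t + j) z ∈ unitBall n := fun j =>
    hf.mapsTo_transition ht (hj j) hzB
  have hsucc : ∀ j : ℕ, loewnerTransition f t (t + j + 1) z
      = loewnerTransition f (t + j) (t + j + 1) (loewnerTransition f t (t + j) z) := fun j =>
    (hf.transition_transition ht (hj j) hzB).symm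
  have hstep : ∀ j : ℕ,
      Real.exp j * ‖loewnerTransition f t (t + j) z‖ ≤ (2 - (1 / 2) ^ j) * ‖z‖ →
      ‖(Real.exp (j + 1) : ℂ) • loewnerTransition f t (t + j + 1) z
        - (Real.exp j : ℂ) • loewnerTransition f t (t + j) z‖ ≤ (1 / 2) ^ j * ‖z‖ / 2 := by
    intro j hA
    -- The step from `j` to `j + 1` costs at most `6 e^j ‖y‖²`, where `e^j ‖y‖ ≤ 2 ‖z‖` and
    -- `‖y‖ ≤ 2^{-j} / 24`; the radius `1 / 48` makes this `2^{-j} ‖z‖ / 2`.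
    set y := loewnerTransition f t (t + j) z
    have hpow : (0 : ℝ) < (1 / 2) ^ j := by positivity
    have hA2 : Real.exp j * ‖y‖ ≤ 2 * ‖z‖ := hA.trans (by gcongr; linarith)
    have hexp : (2 : ℝ) ^ j ≤ Real.exp j := by
      rw [← Real.exp_one_pow]
      exact pow_le_pow_left₀ (by norm_num) (by linarith [Real.add_one_le_exp (1 : ℝ)]) j
    have hy : ‖y‖ ≤ (1 / 2) ^ j * (1 / 24) := by
      have h1 : (2 : ℝ) ^ j * ‖y‖ ≤ 1 / 24 :=
        (mul_le_mul_of_nonneg_right hexp (norm_nonneg _)).trans (by linarith)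
      rw [one_div, inv_pow, inv_mul_eq_div, le_div_iff₀ (by positivity)]
      linarith
    have h2 : (Real.exp (j + 1) : ℂ) • loewnerTransition f t (t + j + 1) z - (Real.exp j : ℂ) • y
        = (Real.exp j : ℂ) •
          ((Real.exp 1 : ℂ) • loewnerTransition f (t + j) (t + j + 1) y - y) := by
      rw [smul_sub, smul_smul, ← Complex.ofReal_mul, ← Real.exp_add, hsucc]
    rw [h2, norm_smul, Complex.norm_real, Real.norm_of_nonneg (Real.exp_nonneg _)]
    calc Real.exp j * ‖(Real.exp 1 : ℂ) • loewnerTransition f (t + j) (t + j + 1) y - y‖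
        ≤ Real.exp j * (6 * ‖y‖ ^ 2) := by
          gcongr
          exact hf.norm_exp_smul_transition_one_sub_le (ht.trans (hj j)) (hmem j)
      _ = 6 * (Real.exp j * ‖y‖) * ‖y‖ := by ring
      _ ≤ 6 * (2 * ‖z‖) * ((1 / 2) ^ j * (1 / 24)) := by gcongr
      _ = (1 / 2) ^ j * ‖z‖ / 2 := by ring
  have hA : Real.exp j * ‖loewnerTransition f t (t + j) z‖ ≤ (2 - (1 / 2) ^ j) * ‖z‖ := by
    induction j with
    | zero =>
      have := hf.norm_transition_le ht le_rfl hzB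
      simp only [Nat.cast_zero, Real.exp_zero, add_zero, pow_zero]
      linarith
    | succ j ih =>
      have h := hstep j ih
      have h1 := norm_sub_norm_le ((Real.exp (j + 1) : ℂ) • loewnerTransition f t (t + j + 1) z)
        ((Real.exp j : ℂ) • loewnerTransition f t (t + j) z)
      rw [norm_smul, norm_smul, Complex.norm_real, Complex.norm_real,
        Real.norm_of_nonneg (Real.exp_nonneg _), Real.norm_of_nonneg (Real.exp_nonneg _)] at h1
      push_cast
      rw [← add_assoc, pow_succ]
      linarith
  exact ⟨hA, hstep j hA⟩

/-- The transition maps contract every point of the ball to the origin. -/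
theorem IsNormalizedLoewnerChain.exists_norm_transition_lt (hf : IsNormalizedLoewnerChain f)
    (ht : 0 ≤ t) (hz : z ∈ unitBall n) {ε : ℝ} (hε : 0 < ε) :
    ∃ N : ℕ, ‖loewnerTransition f t (t + N) z‖ < ε := by
  have hz1 := mem_unitBall_iff.1 hz
  set r := ‖z‖
  have hr0 : 0 ≤ r := norm_nonneg z
  -- The time step `N` is so large that one step contracts by the factor `q` on the ball of radius
  -- `r`.
  set q := (1 + r) / 2 with hq
  obtain ⟨N, hN⟩ : ∃ N : ℕ, Real.exp (-N) < (1 - r) / 4 :=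
    ((Real.tendsto_exp_neg_atTop_nhds_zero.comp tendsto_natCast_atTop_atTop).eventually_lt_const
      (by linarith : (0 : ℝ) < (1 - r) / 4)).exists
  have hle : ∀ j : ℕ, t ≤ t + (N * j : ℕ) := fun j => by
    simp only [le_add_iff_nonneg_right]
    positivity
  have hdec : ∀ j : ℕ, ‖loewnerTransition f t (t + (N * j : ℕ)) z‖ ≤ q ^ j * r := by
    intro j
    induction j with
    | zero => simpa using hf.norm_transition_le ht le_rfl hz
    | succ j ih =>
      set y := loewnerTransition f t (t + (N * j : ℕ)) z with hy
      have hyB : y ∈ unitBall n := hf.mapsTo_transition ht (hle j) hz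
      have hyr : ‖y‖ ≤ r := hf.norm_transition_le ht (hle j) hz
      have hle' : t + (N * j : ℕ) ≤ t + (N * (j + 1) : ℕ) := by
        push_cast
        nlinarith [(Nat.cast_nonneg N : (0 : ℝ) ≤ N)]
      have h := hf.norm_transition_sub_le (ht.trans (hle j)) hle' hyB
      have hexp : t + (N * j : ℕ) - (t + (N * (j + 1) : ℕ)) = -(N : ℝ) := by
        push_cast
        ring
      rw [hexp, hy, hf.transition_transition ht (hle j) hz, ← hy] at h
      set c := Real.exp (-(N : ℝ))
      have hc : 0 < c := Real.exp_pos _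
      have h1 := norm_sub_norm_le (loewnerTransition f t (t + (N * (j + 1) : ℕ)) z) ((c : ℂ) • y)
      rw [norm_smul, Complex.norm_real, Real.norm_of_nonneg hc.le] at h1
      calc ‖loewnerTransition f t (t + (N * (j + 1) : ℕ)) z‖
          ≤ c * ‖y‖ + (1 + c) * ‖y‖ ^ 2 := by linarith
        _ = (c + (1 + c) * ‖y‖) * ‖y‖ := by ring
        _ ≤ q * (q ^ j * r) := by
          gcongr
          calc c + (1 + c) * ‖y‖ ≤ c + (1 + c) * r := by gcongr
            _ ≤ q := by nlinarith
        _ = q ^ (j + 1) * r := by ring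
  have hlim : Tendsto (fun j : ℕ => q ^ j * r) atTop (𝓝 (0 * r)) :=
    (tendsto_pow_atTop_nhds_zero_of_lt_one (by linarith) (by linarith)).mul_const r
  rw [zero_mul] at hlim
  obtain ⟨j, hj⟩ := (hlim.eventually_lt_const hε).exists
  exact ⟨N * j, (hdec j).trans_lt hj⟩

/-- The limit `lim_k e^k f_k⁻¹` of the rescaled inverses. -/
noncomputable def loewnerLimit (f : ℝ → CSpace n → CSpace n) (w : CSpace n) : CSpace n :=
  limUnder atTop fun k : ℕ => (Real.exp k : ℂ) • Function.invFunOn (f k) (unitBall n) w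

theorem IsNormalizedLoewnerChain.tendstoUniformlyOn_loewnerLimit (hf : IsNormalizedLoewnerChain f)
    (m : ℕ) :
    TendstoUniformlyOn (fun (j : ℕ) z => (Real.exp j : ℂ) • loewnerTransition f m (m + j) z)
      (fun z => (Real.exp (-m) : ℂ) • loewnerLimit f (f m z)) atTop (ball 0 (1 / 48)) := by
  have hgeo : ∀ z ∈ ball (0 : CSpace n) (1 / 48), ∀ j : ℕ,
      dist ((Real.exp j : ℂ) • loewnerTransition f m (m + j) z)
        ((Real.exp (j + 1 : ℕ) : ℂ) • loewnerTransition f m (m + (j + 1 : ℕ)) z)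
        ≤ 1 * (1 / 2) ^ j := by
    intro z hz j
    have hz' : ‖z‖ ≤ 1 / 48 := (mem_ball_zero_iff.1 hz).le
    have h := (hf.exp_mul_norm_transition_le m.cast_nonneg hz' j).2
    rw [dist_eq_norm, norm_sub_rev]
    push_cast at h ⊢
    rw [← add_assoc]
    refine h.trans ?_
    have : (0 : ℝ) < (1 / 2) ^ j := by positivity
    nlinarith
  have hlim : ∀ z ∈ ball (0 : CSpace n) (1 / 48),
      Tendsto (fun j : ℕ => (Real.exp j : ℂ) • loewnerTransition f m (m + j) z) atTop
        (𝓝 ((Real.exp (-m) : ℂ) • loewnerLimit f (f m z))) := by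
    intro z hz
    obtain ⟨L, hL⟩ := cauchySeq_tendsto_of_complete
      (cauchySeq_of_le_geometric (1 / 2) 1 (by norm_num) (hgeo z hz))
    have h1 : Tendsto (fun k : ℕ => (Real.exp k : ℂ) •
        Function.invFunOn (f k) (unitBall n) (f m z)) atTop (𝓝 ((Real.exp m : ℂ) • L)) := by
      rw [← tendsto_add_atTop_iff_nat m]
      refine (hL.const_smul (Real.exp m : ℂ)).congr fun j => ?_
      rw [smul_smul, ← Complex.ofReal_mul, ← Real.exp_add, loewnerTransition]
      push_cast
      rw [add_comm (j : ℝ)]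
      rw [add_comm (j : ℂ)]
    rw [loewnerLimit, h1.limUnder_eq, smul_smul, ← Complex.ofReal_mul, ← Real.exp_add]
    simpa using hL
  rw [Metric.tendstoUniformlyOn_iff]
  intro ε hε
  have h2 : Tendsto (fun j : ℕ => (1 : ℝ) * (1 / 2) ^ j / (1 - 1 / 2)) atTop
      (𝓝 (1 * 0 / (1 - 1 / 2))) :=
    ((tendsto_pow_atTop_nhds_zero_of_lt_one (by norm_num) (by norm_num)).const_mul 1).div_const _
  rw [mul_zero, zero_div] at h2
  filter_upwards [h2.eventually_lt_const hε] with j hj z hz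
  rw [dist_comm]
  exact (dist_le_of_le_geometric_of_tendsto (1 / 2) 1 (by norm_num) (hgeo z hz) (hlim z hz)
    j).trans_lt hj

end Limit

/-! ### The range of the chain -/

section Range

variable {n : ℕ} {f : ℝ → CSpace n → CSpace n} {s t : ℝ} {z : CSpace n}

theorem IsSubordinationChain.isOpen_loewnerRange (hf : IsSubordinationChain f) :
    IsOpen (loewnerRange f) :=
  isOpen_biUnion fun _ ht => hf.isOpen_image ht (isOpen_unitBall n) subset_rfl

theorem ball_subset_unitBall {r : ℝ} (hr : r ≤ 1) : ball (0 : CSpace n) r ⊆ unitBall n :=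
  ball_subset_ball hr

/-- The range is already exhausted by the images of a fixed smaller ball, at integer times. -/
theorem IsNormalizedLoewnerChain.exists_eq_of_mem_loewnerRange (hf : IsNormalizedLoewnerChain f)
    {w : CSpace n} (hw : w ∈ loewnerRange f) {ε : ℝ} (hε : 0 < ε) :
    ∃ m : ℕ, ∃ z ∈ ball (0 : CSpace n) ε, z ∈ unitBall n ∧ f m z = w := by
  obtain ⟨t, ht, hw⟩ := mem_iUnion₂.1 hw
  obtain ⟨z, hz, rfl⟩ := hf.subset t ⌈t⌉₊ ht (Nat.le_ceil t) hw
  obtain ⟨N, hN⟩ := hf.exists_norm_transition_lt (Nat.cast_nonneg ⌈t⌉₊) hz hε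
  have hle : (⌈t⌉₊ : ℝ) ≤ ⌈t⌉₊ + N := by simp
  refine ⟨⌈t⌉₊ + N, _, mem_ball_zero_iff.2 hN,
    hf.mapsTo_transition (Nat.cast_nonneg _) hle hz, ?_⟩
  push_cast
  exact hf.apply_transition (Nat.cast_nonneg _) hle hz

/-- The maps `e^{-m} Ψ ∘ f_m`, where `Ψ` is the limit of the rescaled inverses, form a uniformly
bounded family of normalized holomorphic maps near the origin. -/
theorem IsNormalizedLoewnerChain.loewnerLimit_comp (hf : IsNormalizedLoewnerChain f) (m : ℕ) :
    DifferentiableOn ℂ (fun z => (Real.exp (-m) : ℂ) • loewnerLimit f (f m z)) (ball 0 (1 / 48)) ∧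
    (∀ z ∈ ball (0 : CSpace n) (1 / 48), ‖(Real.exp (-m) : ℂ) • loewnerLimit f (f m z)‖ ≤ 1) ∧
    (Real.exp (-m) : ℂ) • loewnerLimit f (f m 0) = 0 ∧
    HasFDerivAt (fun z => (Real.exp (-m) : ℂ) • loewnerLimit f (f m z))
      (ContinuousLinearMap.id ℂ (CSpace n)) 0 := by
  have hunif := hf.tendstoUniformlyOn_loewnerLimit m
  have hm : (0 : ℝ) ≤ m := m.cast_nonneg
  have hle : ∀ j : ℕ, (m : ℝ) ≤ m + j := fun j => by simp
  have hdiff : ∀ j : ℕ, DifferentiableOn ℂ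
      (fun z => (Real.exp j : ℂ) • loewnerTransition f m (m + j) z) (ball 0 (1 / 48)) := fun j =>
    ((hf.differentiableOn_transition hm (hle j)).mono
      (ball_subset_unitBall (r := 1 / 48) (by norm_num))).fun_const_smul _
  have hball0 : (0 : CSpace n) ∈ ball (0 : CSpace n) (1 / 48) := mem_ball_self (by norm_num)
  refine ⟨fun z hz => ?_, fun z hz => ?_, ?_, ?_⟩
  · obtain ⟨r, hr, hrz⟩ := Metric.isOpen_iff.1 isOpen_ball z hz
    obtain ⟨g', hg', -⟩ := hasFDerivAt_of_tendstoUniformlyOn_ball hr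
      (fun j => (hdiff j).mono hrz) (hunif.mono hrz)
    exact hg'.differentiableAt.differentiableWithinAt
  · refine le_of_tendsto (hunif.tendsto_at hz).norm (Eventually.of_forall fun j => ?_)
    have hz' := (mem_ball_zero_iff.1 hz).le
    have h := (hf.exp_mul_norm_transition_le hm hz' j).1
    rw [norm_smul, Complex.norm_real, Real.norm_of_nonneg (Real.exp_nonneg _)]
    have : (0 : ℝ) < (1 / 2) ^ j := by positivity
    nlinarith [norm_nonneg z]
  · refine tendsto_nhds_unique (hunif.tendsto_at hball0) (tendsto_const_nhds.congr fun j => ?_)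
    rw [hf.transition_zero hm (hle j), smul_zero]
  · obtain ⟨g', hg', hlim⟩ := hasFDerivAt_of_tendstoUniformlyOn_ball (by norm_num) hdiff hunif
    suffices h : ContinuousLinearMap.id ℂ (CSpace n) = g' from h ▸ hg'
    refine tendsto_nhds_unique (tendsto_const_nhds.congr fun j => ?_) hlim
    have hd := (hf.hasFDerivAt_transition hm (hle j)).const_smul (Real.exp j : ℂ)
    rw [smul_smul, ← Complex.ofReal_mul, ← Real.exp_add] at hd
    have hexp : (j : ℝ) + (m - (m + j)) = 0 := by ring
    rw [hexp, Real.exp_zero, Complex.ofReal_one, one_smul] at hd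
    exact hd.fderiv.symm

theorem ofReal_exp_smul_neg_smul (t : ℝ) (v : CSpace n) :
    (Real.exp t : ℂ) • (Real.exp (-t) : ℂ) • v = v := by
  rw [smul_smul, ← Complex.ofReal_mul, ← Real.exp_add]
  simp

theorem exists_nat_exp_neg_smul_mem_ball (v : CSpace n) {δ : ℝ} (hδ : 0 < δ) :
    ∃ m : ℕ, (Real.exp (-m) : ℂ) • v ∈ ball (0 : CSpace n) δ := by
  have hlim : Tendsto (fun m : ℕ => Real.exp (-m) * ‖v‖) atTop (𝓝 (0 * ‖v‖)) :=
    (Real.tendsto_exp_neg_atTop_nhds_zero.comp tendsto_natCast_atTop_atTop).mul_const _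
  rw [zero_mul] at hlim
  obtain ⟨m, hm⟩ := (hlim.eventually_lt_const hδ).exists
  refine ⟨m, ?_⟩
  rwa [mem_ball_zero_iff, norm_smul, Complex.norm_real, Real.norm_of_nonneg (Real.exp_nonneg _)]

theorem IsNormalizedLoewnerChain.differentiableOn_loewnerLimit (hf : IsNormalizedLoewnerChain f) :
    DifferentiableOn ℂ (loewnerLimit f) (loewnerRange f) := by
  intro w hw
  obtain ⟨m, z, hz, hzB, rfl⟩ :=
    hf.exists_eq_of_mem_loewnerRange hw (by norm_num : (0 : ℝ) < 1 / 48)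
  have hm : (0 : ℝ) ≤ m := m.cast_nonneg
  have hsub : ball (0 : CSpace n) (1 / 48) ⊆ unitBall n := ball_subset_unitBall (by norm_num)
  have hopen : IsOpen (f m '' ball 0 (1 / 48)) := hf.isOpen_image hm isOpen_ball hsub
  have hinv : MapsTo (Function.invFunOn (f m) (unitBall n)) (f m '' ball 0 (1 / 48))
      (ball 0 (1 / 48)) := by
    rintro _ ⟨y, hy, rfl⟩
    rwa [(hf.univalent m hm).2.leftInvOn_invFunOn (hsub hy)]
  have hd := ((hf.loewnerLimit_comp m).1.const_smul (Real.exp m : ℂ)).comp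
    ((hf.differentiableOn_invFunOn hm).mono (image_mono hsub)) hinv
  have heq : EqOn (loewnerLimit f) (fun w => (Real.exp m : ℂ) • (Real.exp (-m) : ℂ) •
      loewnerLimit f (f m (Function.invFunOn (f m) (unitBall n) w))) (f m '' ball 0 (1 / 48)) :=
    fun w hw => by
      beta_reduce
      rw [ofReal_exp_smul_neg_smul, Function.invFunOn_eq (image_mono hsub hw)]
  exact ((hd.congr heq).differentiableAt
    (hopen.mem_nhds (mem_image_of_mem _ hz))).differentiableWithinAt

theorem IsNormalizedLoewnerChain.injOn_loewnerLimit (hf : IsNormalizedLoewnerChain f) :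
    InjOn (loewnerLimit f) (loewnerRange f) := by
  intro w hw w' hw' heq
  -- The points are moved to times so late that they lie close to the origin, where
  -- `e^{-m} Ψ ∘ f_m` is injective, being close to the identity: on the ball of radius `σ` the
  -- difference has Lipschitz constant `8 * 2 * 48 ^ 2 * σ < 1`.
  set σ : ℝ := 1 / 100000 with hσ
  obtain ⟨m, z, hz, hzB, rfl⟩ := hf.exists_eq_of_mem_loewnerRange hw (by norm_num : 0 < σ)
  obtain ⟨m', z', hz', hzB', rfl⟩ := hf.exists_eq_of_mem_loewnerRange hw' (by norm_num : 0 < σ)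
  set p := max m m'
  have hm : (0 : ℝ) ≤ m := m.cast_nonneg
  have hm' : (0 : ℝ) ≤ m' := m'.cast_nonneg
  have hmp : (m : ℝ) ≤ p := by exact_mod_cast le_max_left m m'
  have hmp' : (m' : ℝ) ≤ p := by exact_mod_cast le_max_right m m'
  have hy := (hf.norm_transition_le hm hmp hzB).trans (mem_ball_zero_iff.1 hz).le
  have hy' := (hf.norm_transition_le hm' hmp' hzB').trans (mem_ball_zero_iff.1 hz').le
  rw [← hf.apply_transition hm hmp hzB, ← hf.apply_transition hm' hmp' hzB'] at heq ⊢
  set y := loewnerTransition f m p z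
  set y' := loewnerTransition f m' p z'
  obtain ⟨hd, hM, -, hid⟩ := hf.loewnerLimit_comp p
  have h := norm_sub_le_of_fderiv_zero_eq_zero
    (G := fun z => (Real.exp (-p) : ℂ) • loewnerLimit f (f p z) - z) (M := 2)
    (by norm_num : σ < 1 / 48 / 2)
    (hd.sub differentiableOn_id) (fun z hz => (norm_sub_le _ _).trans
      ((add_le_add (hM z hz) (mem_ball_zero_iff.1 hz).le).trans (by norm_num)))
    (sub_self (ContinuousLinearMap.id ℂ (CSpace n)) ▸ hid.sub (hasFDerivAt_id 0)) hy hy'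
  rw [heq, sub_sub_sub_cancel_left, norm_sub_rev] at h
  have h0 : ‖y - y'‖ = 0 := by
    rw [hσ] at h
    norm_num at h
    linarith [norm_nonneg (y - y')]
  rw [sub_eq_zero.1 (norm_eq_zero.1 h0)]

theorem IsNormalizedLoewnerChain.image_loewnerLimit (hf : IsNormalizedLoewnerChain f) :
    loewnerLimit f '' loewnerRange f = univ := by
  refine eq_univ_of_forall fun v => ?_
  obtain ⟨m, hm⟩ := exists_nat_exp_neg_smul_mem_ball v
    (by norm_num : (0 : ℝ) < (1 / 48) ^ 2 / (32 * (1 + 1 / 48)))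
  obtain ⟨hd, hM, h0, hid⟩ := hf.loewnerLimit_comp m
  obtain ⟨z, hz, hzv⟩ :=
    ball_subset_image_of_forall_norm_le (by norm_num) hd hM h0 hid hm
  refine ⟨f m z, mem_iUnion₂.2 ⟨m, mem_Ici.2 m.cast_nonneg, mem_image_of_mem _
    (ball_subset_unitBall (by norm_num) hz)⟩, ?_⟩
  have := congrArg (fun v => (Real.exp m : ℂ) • v) hzv
  simpa only [ofReal_exp_smul_neg_smul] using this

theorem IsNormalizedLoewnerChain.areBiholomorphic_univ (hf : IsNormalizedLoewnerChain f) :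
    AreBiholomorphic (loewnerRange f) univ := by
  have hinv := hf.injOn_loewnerLimit.leftInvOn_invFunOn
  have himg := hf.image_loewnerLimit
  refine ⟨hf.isOpen_loewnerRange, isOpen_univ, loewnerLimit f,
    Function.invFunOn (loewnerLimit f) (loewnerRange f), hf.differentiableOn_loewnerLimit, ?_,
    mapsTo_univ _ _, fun v _ => ?_, hinv, fun v _ => ?_⟩
  · rw [← himg]
    exact differentiableOn_image_of_leftInvOn rfl hf.isOpen_loewnerRange
      hf.differentiableOn_loewnerLimit hinv
  · exact Function.invFunOn_mem (himg ▸ mem_univ v : v ∈ loewnerLimit f '' loewnerRange f)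
  · exact Function.invFunOn_eq (himg ▸ mem_univ v : v ∈ loewnerLimit f '' loewnerRange f)

theorem IsNormalizedLoewnerChain.loewnerRange_eq_univ (hf : IsNormalizedLoewnerChain f)
    (hb : IsUniformlyBoundedNearZero f) : loewnerRange f = univ := by
  obtain ⟨U, hU, hUB, M, hM⟩ := hb
  obtain ⟨ρ, hρ, hρU⟩ := Metric.mem_nhds_iff.1 hU
  have hM0 : 0 ≤ M := (norm_nonneg _).trans (hM 0 le_rfl 0 (hρU (mem_ball_self hρ)))
  refine eq_univ_of_forall fun v => ?_
  obtain ⟨m, hm⟩ := exists_nat_exp_neg_smul_mem_ball v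
    (by positivity : (0 : ℝ) < ρ ^ 2 / (32 * (M + ρ)))
  have hm0 : (0 : ℝ) ≤ m := m.cast_nonneg
  have hid : HasFDerivAt (fun z => (Real.exp (-m) : ℂ) • f m z)
      (ContinuousLinearMap.id ℂ (CSpace n)) 0 := by
    have h := (hf.hasFDerivAt_zero m hm0).const_smul (Real.exp (-m) : ℂ)
    rw [smul_smul, ← Complex.ofReal_mul, ← Real.exp_add] at h
    simpa using! h
  obtain ⟨z, hz, hzv⟩ := ball_subset_image_of_forall_norm_le hρ
    (((hf.univalent m hm0).1.mono (hρU.trans hUB)).const_smul (Real.exp (-m) : ℂ))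
    (fun z hz => hM m hm0 z (hρU hz)) (by simp [hf.map_zero m hm0]) hid hm
  refine mem_iUnion₂.2 ⟨m, hm0, z, hUB (hρU hz), ?_⟩
  have := congrArg (fun v => (Real.exp m : ℂ) • v) hzv
  simpa only [Pi.smul_apply, ofReal_exp_smul_neg_smul] using this

end Range

end LoewnerChains

theorem mainTheorem4 (n : ℕ) (f : ℝ → CSpace n → CSpace n)
    (hf : IsNormalizedLoewnerChain f) :
    IsLoewnerChainOfOrder ∞ f ∧
      AreBiholomorphic (loewnerRange f) Set.univ ∧
      (IsUniformlyBoundedNearZero f → loewnerRange f = Set.univ) :=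
  ⟨hf.isLoewnerChainOfOrder_top, hf.areBiholomorphic_univ, hf.loewnerRange_eq_univ⟩
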